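/- A (nondegenerate) Orlicz function is a continuous, nondecreasing, convex function $M:[0,\infty)\to[0,\infty)$ with $M(0)=0$, $M(t)>0$ for $t>0$ and $\lim_{t\to\infty}M(t)=\infty$. Its Matuszewska--Orlicz indices are $$\alpha_M=\sup\Big\{q\in\mathbb R:\sup_{\lambda,t\in(0,1]}\tfrac{M(\lambda t)}{M(\lambda)t^q}<\infty\Big\},\qquad \beta_M=\inf\Big\{q\in\mathbb R:\inf_{\lambda,t\in(0,1]}\tfrac{M(\lambda t)}{M(\lambda)t^q}>0\Big\}$$ (in the extended reals), and $h_M$ is the space of all real sequences $x=(x_n)$ with $\sum_n M(|x_n|/\rho)<\infty$ for every $\rho>0$, with the norm $\|x\|=\inf\{\rho>0:\sum_n M(|x_n|/\rho)\le 1\}$. A map $f:X\to Y$ between metric spaces is a coarse embedding if there are nondecreasing $\rho_1,\rho_2:[0,\infty)\to[0,\infty)$ with $\lim_{t\to\infty}\rho_1(t)=\infty$ and $\rho_1(d(x,y))\le d(f(x),f(y))\le\rho_2(d(x,y))$ for all $x,y\in X$; it is a uniform embedding if it is injective and both $f$ and $f^{-1}:f(X)\to X$ are uniformly continuous; it is a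 strong uniform embedding if it is both. The space $X$ embeds into $Y$ in one of these senses if there is such an $f$. **Statement.** There is an Orlicz function $M$ with $M(t)=\dfrac{t^2}{1-\log t}$ for every $t\in(0,1]$ and $\alpha_M=\beta_M=2$, such that for every $1\le p\le 2$ the space $h_M$ neither coarsely embeds nor uniformly embeds into the real sequence space $\ell_p$. On the other hand, the Orlicz function $M_0(t)=t^2$ also satisfies $\alpha_{M_0}=\beta_{M_0}=2$, and $h_{M_0}$ strongly uniformly embeds into $\ell_p$ for every $1\le p\le 2$. Hence, when $\beta_M=2$, the coarse or uniform embeddability of $h_M$ into $\ell_p$ is not determined by the indices. -/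

import Mathlib

open Set Filter Topology
open scoped NNReal ENNReal

noncomputable section

/-- A nondegenerate Orlicz function `M : [0,∞) → [0,∞)`. It is represented by a function on `ℝ` of
which only the values on `[0,∞)` are ever used; these are nonnegative because `M 0 = 0` and `M` is
nondecreasing there. -/
structure OrliczFunction where
  toFun : ℝ → ℝ
  continuousOn' : ContinuousOn toFun (Ici 0)
  monotoneOn' : MonotoneOn toFun (Ici 0)
  convexOn' : ConvexOn ℝ (Ici 0) toFun
  map_zero' : toFun 0 = 0
  tendsto' : Tendsto toFun atTop atTop
  nondegenerate' : ∀ t : ℝ, 0 < t → toFun t ≠ 0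

namespace OrliczFunction

instance : CoeFun OrliczFunction (fun _ => ℝ → ℝ) := ⟨OrliczFunction.toFun⟩

variable (M : OrliczFunction)

/-- The lower Matuszewska-Orlicz index `α_M`, a supremum in the extended reals. -/
def lowerIndex : EReal :=
  sSup ((fun q : ℝ => (q : EReal)) ''
    {q : ℝ | ∃ C : ℝ, ∀ s ∈ Ioc (0 : ℝ) 1, ∀ t ∈ Ioc (0 : ℝ) 1, M (s * t) / (M s * t ^ q) ≤ C})

/-- The upper Matuszewska-Orlicz index `β_M`, an infimum in the extended reals. -/
def upperIndex : EReal :=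
  sInf ((fun q : ℝ => (q : EReal)) ''
    {q : ℝ | ∃ c : ℝ, 0 < c ∧
      ∀ s ∈ Ioc (0 : ℝ) 1, ∀ t ∈ Ioc (0 : ℝ) 1, c ≤ M (s * t) / (M s * t ^ q)})

/-- The sum `∑ M(|x_n| / ρ)`, with values in `[0,∞]`. -/
def modular (x : ℕ → ℝ) (ρ : ℝ) : ℝ≥0∞ := ∑' n, ENNReal.ofReal (M (|x n| / ρ))

/-! Elementary facts needed to see that the Luxemburg norm is a norm. -/

theorem modular_zero (ρ : ℝ) : M.modular 0 ρ = 0 := by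
  simp [modular, M.map_zero']

theorem modular_anti (x : ℕ → ℝ) {ρ σ : ℝ} (hρ : 0 < ρ) (h : ρ ≤ σ) :
    M.modular x σ ≤ M.modular x ρ := by
  refine ENNReal.tsum_le_tsum fun n => ENNReal.ofReal_le_ofReal ?_
  have hσ : 0 < σ := hρ.trans_le h
  exact M.monotoneOn' (mem_Ici.2 (by positivity)) (mem_Ici.2 (by positivity))
    (div_le_div_of_nonneg_left (abs_nonneg _) hρ h)

theorem modular_smul (c : ℝ) (hc : c ≠ 0) (x : ℕ → ℝ) (ρ : ℝ) :
    M.modular (c • x) ρ = M.modular x (ρ / |c|) := by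
  have hc' : |c| ≠ 0 := abs_ne_zero.2 hc
  unfold modular
  congr 1; ext n; congr 2
  simp only [Pi.smul_apply, smul_eq_mul, abs_mul]
  rw [div_div_eq_mul_div, mul_comm]

theorem modular_add_le (x y : ℕ → ℝ) {ρ σ : ℝ} (hρ : 0 < ρ) (hσ : 0 < σ) :
    M.modular (x + y) (ρ + σ) ≤ ENNReal.ofReal (ρ / (ρ + σ)) * M.modular x ρ +
      ENNReal.ofReal (σ / (ρ + σ)) * M.modular y σ := by
  unfold modular
  rw [← ENNReal.tsum_mul_left, ← ENNReal.tsum_mul_left, ← ENNReal.tsum_add]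
  refine ENNReal.tsum_le_tsum fun n => ?_
  have h0 : ∀ t : ℝ, 0 ≤ t → 0 ≤ M t := fun t ht => by
    have := M.monotoneOn' (mem_Ici.2 le_rfl) (mem_Ici.2 ht) ht
    rwa [M.map_zero'] at this
  have hx : 0 ≤ |x n| / ρ := by positivity
  have hy : 0 ≤ |y n| / σ := by positivity
  rw [← ENNReal.ofReal_mul (by positivity), ← ENNReal.ofReal_mul (by positivity),
    ← ENNReal.ofReal_add (mul_nonneg (by positivity) (h0 _ hx))
      (mul_nonneg (by positivity) (h0 _ hy))]
  refine ENNReal.ofReal_le_ofReal ?_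
  have ha : 0 ≤ ρ / (ρ + σ) := by positivity
  have hb : 0 ≤ σ / (ρ + σ) := by positivity
  have hab : ρ / (ρ + σ) + σ / (ρ + σ) = 1 := by field_simp
  have hconv := M.convexOn'.2 (mem_Ici.2 hx) (mem_Ici.2 hy) ha hb hab
  simp only [smul_eq_mul] at hconv
  refine le_trans (M.monotoneOn' (mem_Ici.2 (by positivity)) (mem_Ici.2 (by positivity)) ?_) hconv
  have : ρ / (ρ + σ) * (|x n| / ρ) + σ / (ρ + σ) * (|y n| / σ) = (|x n| + |y n|) / (ρ + σ) := by
    field_simp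
  rw [this]
  gcongr
  exact abs_add_le _ _

theorem modular_add_lt_top (x y : ℕ → ℝ) {ρ σ : ℝ} (hρ : 0 < ρ) (hσ : 0 < σ)
    (hx : M.modular x ρ < ∞) (hy : M.modular y σ < ∞) : M.modular (x + y) (ρ + σ) < ∞ :=
  (M.modular_add_le x y hρ hσ).trans_lt (ENNReal.add_lt_top.2
    ⟨ENNReal.mul_lt_top ENNReal.ofReal_lt_top hx, ENNReal.mul_lt_top ENNReal.ofReal_lt_top hy⟩)

/-- The real sequences `x` with `∑ M(|x_n| / ρ) < ∞` for some `ρ > 0`, as a vector space. -/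
def ellSubmodule : Submodule ℝ (ℕ → ℝ) where
  carrier := {x | ∃ ρ : ℝ, 0 < ρ ∧ M.modular x ρ < ∞}
  zero_mem' := ⟨1, one_pos, by rw [M.modular_zero]; exact ENNReal.zero_lt_top⟩
  add_mem' := by
    rintro x y ⟨ρ, hρ, hx⟩ ⟨σ, hσ, hy⟩
    exact ⟨ρ + σ, by positivity, M.modular_add_lt_top x y hρ hσ hx hy⟩
  smul_mem' := by
    rintro c x ⟨ρ, hρ, hx⟩
    by_cases hc : c = 0
    · subst hc
      exact ⟨1, one_pos, by rw [zero_smul, M.modular_zero]; exact ENNReal.zero_lt_top⟩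
    · have hc' : 0 < |c| := abs_pos.2 hc
      refine ⟨ρ * |c|, by positivity, ?_⟩
      rwa [M.modular_smul c hc, mul_div_cancel_right₀ _ hc'.ne']

/-- The Orlicz sequence space `ℓ_M` (a type of its own, so that it does not carry the topology of
pointwise convergence). -/
def Ell : Type := M.ellSubmodule

instance : AddCommGroup M.Ell := inferInstanceAs (AddCommGroup M.ellSubmodule)

instance : Module ℝ M.Ell := inferInstanceAs (Module ℝ M.ellSubmodule)

/-- The underlying sequence of an element of `ℓ_M`. -/
def Ell.seq {M : OrliczFunction} (x : M.Ell) : ℕ → ℝ := Subtype.val (p := (· ∈ M.ellSubmodule)) x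

/-- The Luxemburg norm `‖x‖ = inf {ρ > 0 : ∑ M(|x_n| / ρ) ≤ 1}`. -/
instance : Norm M.Ell := ⟨fun x => sInf {ρ : ℝ | 0 < ρ ∧ M.modular x.seq ρ ≤ 1}⟩

theorem norm_def (x : M.Ell) : ‖x‖ = sInf {ρ : ℝ | 0 < ρ ∧ M.modular x.seq ρ ≤ 1} := rfl

theorem norm_set_bddBelow (x : M.Ell) : BddBelow {ρ : ℝ | 0 < ρ ∧ M.modular x.seq ρ ≤ 1} :=
  ⟨0, fun _ h => h.1.le⟩

theorem norm_set_nonempty (x : M.Ell) : {ρ : ℝ | 0 < ρ ∧ M.modular x.seq ρ ≤ 1}.Nonempty := by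
  obtain ⟨ρ, hρ, hx⟩ : ∃ ρ : ℝ, 0 < ρ ∧ M.modular x.seq ρ < ∞ := Subtype.property x
  set A : ℝ := (M.modular x.seq ρ).toReal with hA
  have hA0 : 0 ≤ A := ENNReal.toReal_nonneg
  have hσ : 0 < ρ * A + 1 := by positivity
  refine ⟨ρ + (ρ * A + 1), by positivity, ?_⟩
  have h := M.modular_add_le x.seq 0 hρ hσ
  rw [add_zero, M.modular_zero, mul_zero, add_zero] at h
  refine h.trans ?_
  rw [← ENNReal.ofReal_toReal hx.ne, ← hA, ← ENNReal.ofReal_mul (by positivity)]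
  refine ENNReal.ofReal_le_one.2 ?_
  rw [div_mul_eq_mul_div, div_le_one (by positivity)]
  linarith

theorem modular_le_one {x : M.Ell} {ρ : ℝ} (h : ‖x‖ < ρ) : 0 < ρ ∧ M.modular x.seq ρ ≤ 1 := by
  obtain ⟨σ, ⟨hσ, hx⟩, hlt⟩ := exists_lt_of_csInf_lt (M.norm_set_nonempty x) h
  exact ⟨hσ.trans hlt, (M.modular_anti _ hσ hlt.le).trans hx⟩

theorem norm_le_of {x : M.Ell} {ρ : ℝ} (hρ : 0 < ρ) (h : M.modular x.seq ρ ≤ 1) : ‖x‖ ≤ ρ :=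
  csInf_le (M.norm_set_bddBelow x) ⟨hρ, h⟩

theorem ell_norm_nonneg (x : M.Ell) : 0 ≤ ‖x‖ := Real.sInf_nonneg fun _ h => h.1.le

theorem ell_norm_zero : ‖(0 : M.Ell)‖ = 0 := by
  refine le_antisymm (le_of_forall_pos_le_add fun ε hε => ?_) (M.ell_norm_nonneg 0)
  rw [zero_add]
  refine M.norm_le_of hε ?_
  change M.modular 0 ε ≤ 1
  rw [M.modular_zero]
  exact zero_le_one

theorem ell_norm_add_le (x y : M.Ell) : ‖x + y‖ ≤ ‖x‖ + ‖y‖ := by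
  refine le_of_forall_pos_le_add fun ε hε => ?_
  obtain ⟨h1, h2⟩ := M.modular_le_one (x := x) (ρ := ‖x‖ + ε / 2) (by linarith)
  obtain ⟨h3, h4⟩ := M.modular_le_one (x := y) (ρ := ‖y‖ + ε / 2) (by linarith)
  have h : ‖x + y‖ ≤ (‖x‖ + ε / 2) + (‖y‖ + ε / 2) := by
    refine M.norm_le_of (by positivity) ((M.modular_add_le x.seq y.seq h1 h3).trans ?_)
    refine (add_le_add (mul_le_mul_right h2 _) (mul_le_mul_right h4 _)).trans ?_
    rw [mul_one, mul_one, ← ENNReal.ofReal_add (by positivity) (by positivity), ← add_div,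
      div_self (by positivity), ENNReal.ofReal_one]
  linarith

theorem ell_norm_smul_le (c : ℝ) (hc : c ≠ 0) (x : M.Ell) : ‖c • x‖ ≤ |c| * ‖x‖ := by
  have hc' : 0 < |c| := abs_pos.2 hc
  refine le_of_forall_pos_le_add fun ε hε => ?_
  obtain ⟨h1, h2⟩ := M.modular_le_one (x := x) (ρ := ‖x‖ + ε / |c|)
    (lt_add_of_pos_right _ (by positivity))
  have h : ‖c • x‖ ≤ |c| * (‖x‖ + ε / |c|) := by
    refine M.norm_le_of (by positivity) ?_
    change M.modular (c • x.seq) _ ≤ 1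
    rw [M.modular_smul c hc, mul_div_cancel_left₀ _ hc'.ne']
    exact h2
  rwa [mul_add, mul_div_cancel₀ _ hc'.ne'] at h

theorem ell_norm_smul (c : ℝ) (x : M.Ell) : ‖c • x‖ = |c| * ‖x‖ := by
  by_cases hc : c = 0
  · subst hc
    rw [zero_smul, M.ell_norm_zero, abs_zero, zero_mul]
  · have hc' : 0 < |c| := abs_pos.2 hc
    refine le_antisymm (M.ell_norm_smul_le c hc x) ?_
    have h := M.ell_norm_smul_le c⁻¹ (inv_ne_zero hc) (c • x)
    rw [inv_smul_smul₀ hc, abs_inv] at h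
    calc |c| * ‖x‖ ≤ |c| * (|c|⁻¹ * ‖c • x‖) := by gcongr
      _ = ‖c • x‖ := by rw [mul_inv_cancel_left₀ hc'.ne']

theorem ell_eq_zero {x : M.Ell} (hx : ‖x‖ = 0) : x = 0 := by
  refine Subtype.ext (funext fun n => ?_)
  change x.seq n = 0
  by_contra hn
  have hn' : 0 < |x.seq n| := abs_pos.2 hn
  obtain ⟨t, ht, ht0⟩ := ((M.tendsto'.eventually_gt_atTop 1).and (eventually_gt_atTop 0)).exists
  obtain ⟨-, h⟩ := M.modular_le_one (x := x) (ρ := |x.seq n| / t) (by rw [hx]; positivity)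
  have h1 := (ENNReal.le_tsum n).trans h
  rw [div_div_cancel₀ hn'.ne', ENNReal.ofReal_le_one] at h1
  linarith

theorem ellCore : NormedSpace.Core ℝ M.Ell where
  norm_nonneg := M.ell_norm_nonneg
  norm_smul c x := by rw [M.ell_norm_smul, Real.norm_eq_abs]
  norm_triangle := M.ell_norm_add_le
  norm_eq_zero_iff x := ⟨M.ell_eq_zero, fun h => by rw [h, M.ell_norm_zero]⟩

instance : NormedAddCommGroup M.Ell := NormedAddCommGroup.ofCore M.ellCore

instance : NormedSpace ℝ M.Ell := NormedSpace.ofCore M.ellCore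

/-- The space `h_M` of all sequences with `∑ M(|x_n| / ρ) < ∞` for every `ρ > 0`, as a subspace of
`ℓ_M`, with the norm of `ℓ_M`. -/
def h : Submodule ℝ M.Ell where
  carrier := {x | ∀ ρ : ℝ, 0 < ρ → M.modular x.seq ρ < ∞}
  zero_mem' := fun ρ _ => by
    change M.modular 0 ρ < ∞
    rw [M.modular_zero]
    exact ENNReal.zero_lt_top
  add_mem' := by
    intro x y hx hy ρ hρ
    have h := M.modular_add_lt_top x.seq y.seq (half_pos hρ) (half_pos hρ)
      (hx _ (half_pos hρ)) (hy _ (half_pos hρ))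
    rwa [add_halves] at h
  smul_mem' := by
    intro c x hx ρ hρ
    change M.modular (c • x.seq) ρ < ∞
    by_cases hc : c = 0
    · subst hc
      rw [zero_smul, M.modular_zero]
      exact ENNReal.zero_lt_top
    · rw [M.modular_smul c hc]
      exact hx _ (div_pos hρ (abs_pos.2 hc))

end OrliczFunction

/-- Coarse embeddings between metric spaces; the control functions are `[0,∞) → [0,∞)`. -/
def IsCoarseEmbedding {X Y : Type*} [MetricSpace X] [MetricSpace Y] (f : X → Y) : Prop :=
  ∃ ρ₁ ρ₂ : ℝ≥0 → ℝ≥0, Monotone ρ₁ ∧ Monotone ρ₂ ∧ Tendsto ρ₁ atTop atTop ∧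
    ∀ x y : X, ρ₁ (nndist x y) ≤ nndist (f x) (f y) ∧ nndist (f x) (f y) ≤ ρ₂ (nndist x y)

def CoarselyEmbeds (X Y : Type*) [MetricSpace X] [MetricSpace Y] : Prop :=
  ∃ f : X → Y, IsCoarseEmbedding f

def UniformlyEmbeds (X Y : Type*) [MetricSpace X] [MetricSpace Y] : Prop :=
  ∃ f : X → Y, IsUniformEmbedding f

/-- A single map is both a coarse and a uniform embedding. -/
def StronglyUniformlyEmbeds (X Y : Type*) [MetricSpace X] [MetricSpace Y] : Prop :=
  ∃ f : X → Y, IsCoarseEmbedding f ∧ IsUniformEmbedding f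

/-- The real Banach space `ℓ_p` of sequences. -/
abbrev RealEllP (p : ℝ≥0∞) : Type := lp (fun _ : ℕ => ℝ) p

end

/-! Nonembeddability comes from a sharp metric cotype 2 inequality on the discrete torus of side
`4k` and dimension `k²`. For maps into `ℓ_p` with `p ≤ 2`, half-period moves in one coordinate
cannot, on average, be much longer than moves by a sign vector (`metric_cotype_lp`,
`le_mul_of_torus`). For complex values this is Fourier analysis, checked on one character at a time
(`AddChar.sum_norm_sq_le`). It passes to the kernel `|a - b| ^ p` because that kernel is a positive
mixture of `|exp (ita) - exp (itb)|²`, and then to `ℓ_p` by summing over coordinates.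

In `h_M` the canonical torus of radius `R` violates the inequality. A half-period move has length at
least `R`, while a sign move changes `2k²` real coordinates by `O(R / k)` each. For `t²` the modular
of such a move would stay bounded away from `0`, but the logarithm in `M` makes it tend to `0` as
`k` grows, so sign moves become arbitrarily short (`exists_torus_logQuad`). Taking `R` large rules
out coarse embeddings, and taking the sign moves short rules out uniform ones.

For `t²` the space is `ℓ_2`. The kernel `exp (-t d²)` is realised by an explicit map into the unit
sphere of `ℓ_2` over words, which the Mazur map carries to `ℓ_p`. Combining the scales `t = 4⁻ⁿ`
gives a Lipschitz map with a lower modulus that is positive and tends to infinity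
(`exists_quad_embedding`). -/

noncomputable section
namespace OrliczFunction

/-! ### The two Orlicz functions and their indices -/

/-- `t² / (1 - log t)` on `[0, 1]`, continued by its tangent line at `1`. -/
def logQuadFun (t : ℝ) : ℝ := if t ≤ 1 then t ^ 2 / (1 - Real.log t) else 3 * t - 2

/-- The derivative of `logQuadFun` on `(0, ∞)`. -/
def logQuadDeriv (t : ℝ) : ℝ :=
  2 * min t 1 / (1 - Real.log (min t 1)) + min t 1 / (1 - Real.log (min t 1)) ^ 2

theorem one_le_one_sub_log {t : ℝ} (h0 : 0 ≤ t) (h1 : t ≤ 1) : 1 ≤ 1 - Real.log t := by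
  linarith [Real.log_nonpos h0 h1]

theorem hasDerivAt_sq_div_one_sub_log {t : ℝ} (h0 : 0 < t) (h1 : t ≤ 1) :
    HasDerivAt (fun t : ℝ => t ^ 2 / (1 - Real.log t)) (logQuadDeriv t) t := by
  have hL := one_le_one_sub_log h0.le h1
  have h := (hasDerivAt_pow 2 t).div ((Real.hasDerivAt_log h0.ne').const_sub 1)
    (by linarith : (1 - Real.log t) ≠ 0)
  refine h.congr_deriv ?_
  unfold logQuadDeriv
  rw [min_eq_left h1]
  have : 1 - Real.log t ≠ 0 := by linarith
  field_simp
  ring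

theorem hasDerivAt_logQuadFun {t : ℝ} (h0 : 0 < t) :
    HasDerivAt logQuadFun (logQuadDeriv t) t := by
  have hlin : ∀ {s : ℝ}, 1 ≤ s → HasDerivAt (fun t : ℝ => 3 * t - 2) (logQuadDeriv s) s := by
    intro s hs
    have h := ((hasDerivAt_id s).const_mul 3).sub_const 2
    refine h.congr_deriv ?_
    unfold logQuadDeriv
    rw [min_eq_right hs]
    norm_num
  rcases lt_trichotomy t 1 with h1 | rfl | h1
  · refine (hasDerivAt_sq_div_one_sub_log h0 h1.le).congr_of_eventuallyEq ?_
    filter_upwards [Iio_mem_nhds h1] with s hs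
    rw [logQuadFun, if_pos (le_of_lt hs)]
  -- Both one-sided derivatives at `1` equal `3`, so they glue.
  · have hl : HasDerivWithinAt logQuadFun (logQuadDeriv 1) (Iic 1) 1 :=
      (hasDerivAt_sq_div_one_sub_log h0 le_rfl).hasDerivWithinAt.congr
        (fun s hs => by rw [logQuadFun, if_pos (mem_Iic.1 hs)]) (by rw [logQuadFun, if_pos le_rfl])
    have hr : HasDerivWithinAt logQuadFun (logQuadDeriv 1) (Ici 1) 1 := by
      have h11 : logQuadFun 1 = 3 * 1 - 2 := by rw [logQuadFun, if_pos le_rfl]; norm_num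
      refine (hlin le_rfl).hasDerivWithinAt.congr (fun s hs => ?_) h11
      rcases (mem_Ici.1 hs).eq_or_lt with rfl | hs'
      · exact h11
      · rw [logQuadFun, if_neg (not_le.2 hs')]
    have := hl.union hr
    rwa [Iic_union_Ici, hasDerivWithinAt_univ] at this
  · refine (hlin h1.le).congr_of_eventuallyEq ?_
    filter_upwards [Ioi_mem_nhds h1] with s hs
    rw [logQuadFun, if_neg (not_le.2 hs)]

theorem logQuadDeriv_nonneg {t : ℝ} (h0 : 0 ≤ t) : 0 ≤ logQuadDeriv t := by
  have h : 0 ≤ min t 1 := le_min h0 zero_le_one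
  have hL := one_le_one_sub_log h (min_le_right _ _)
  have : 0 ≤ 1 - Real.log (min t 1) := by linarith
  unfold logQuadDeriv
  positivity

/-- On `(0, 1]` the numerators increase and `1 - log` decreases to `1`; beyond `1` the minimum
freezes. This yields convexity. -/
theorem monotoneOn_logQuadDeriv : MonotoneOn logQuadDeriv (Ioi 0) := by
  intro s hs t ht hst
  have hs0 : 0 < min s 1 := lt_min hs one_pos
  have hle : min s 1 ≤ min t 1 := min_le_min_right _ hst
  have hL := one_le_one_sub_log (hs0.le.trans hle) (min_le_right _ _)
  have hlog := Real.log_le_log hs0 hle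
  have ht0 : 0 < min t 1 := hs0.trans_le hle
  have h1 : 0 < 1 - Real.log (min t 1) := by linarith
  unfold logQuadDeriv
  gcongr

theorem continuousOn_logQuadFun : ContinuousOn logQuadFun (Ici 0) := by
  intro t ht
  rcases (mem_Ici.1 ht).eq_or_lt with rfl | h0
  · have h00 : logQuadFun 0 = 0 := by simp [logQuadFun]
    rw [ContinuousWithinAt, h00]
    have hsq : Tendsto (fun t : ℝ => t ^ 2) (𝓝[≥] 0) (𝓝 0) := by
      have : Tendsto (fun t : ℝ => t ^ 2) (𝓝 0) (𝓝 (0 ^ 2)) := (continuous_pow 2).tendsto _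
      rw [zero_pow two_ne_zero] at this
      exact this.mono_left nhdsWithin_le_nhds
    have hev : ∀ᶠ t : ℝ in 𝓝[≥] 0, 0 ≤ t ∧ t ≤ 1 := by
      filter_upwards [self_mem_nhdsWithin, nhdsWithin_le_nhds (Iic_mem_nhds one_pos)] with t h h'
      exact ⟨h, h'⟩
    refine tendsto_of_tendsto_of_tendsto_of_le_of_le' tendsto_const_nhds hsq ?_ ?_
    · filter_upwards [hev] with t ht
      have := one_le_one_sub_log ht.1 ht.2
      rw [logQuadFun, if_pos ht.2]
      exact div_nonneg (sq_nonneg t) (by linarith)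
    · filter_upwards [hev] with t ht
      rw [logQuadFun, if_pos ht.2]
      exact div_le_self (sq_nonneg t) (one_le_one_sub_log ht.1 ht.2)
  · exact (hasDerivAt_logQuadFun h0).continuousAt.continuousWithinAt

/-- The Orlicz function that equals `t² / (1 - log t)` on `(0, 1]` and is affine on `[1, ∞)`. -/
def logQuad : OrliczFunction where
  toFun := logQuadFun
  continuousOn' := continuousOn_logQuadFun
  monotoneOn' := by
    refine monotoneOn_of_deriv_nonneg (convex_Ici 0) continuousOn_logQuadFun ?_ ?_
    · rw [interior_Ici]
      exact fun t ht => (hasDerivAt_logQuadFun ht).differentiableAt.differentiableWithinAt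
    · rw [interior_Ici]
      intro t ht
      rw [(hasDerivAt_logQuadFun ht).deriv]
      exact logQuadDeriv_nonneg (le_of_lt ht)
  convexOn' := by
    refine MonotoneOn.convexOn_of_deriv (convex_Ici 0) continuousOn_logQuadFun ?_ ?_
    · rw [interior_Ici]
      exact fun t ht => (hasDerivAt_logQuadFun ht).differentiableAt.differentiableWithinAt
    · rw [interior_Ici]
      exact monotoneOn_logQuadDeriv.congr fun t ht => (hasDerivAt_logQuadFun ht).deriv.symm
  map_zero' := by simp [logQuadFun]
  tendsto' := by
    refine tendsto_atTop_mono' _ ?_ tendsto_id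
    filter_upwards [eventually_gt_atTop 1] with t ht
    rw [logQuadFun, if_neg (not_le.2 ht)]
    simp only [id]
    linarith
  nondegenerate' := fun t ht => by
    unfold logQuadFun
    split_ifs with h
    · have := one_le_one_sub_log ht.le h
      have : 0 < 1 - Real.log t := by linarith
      positivity
    · push Not at h
      linarith

theorem logQuad_apply {t : ℝ} (h1 : t ≤ 1) : logQuad t = t ^ 2 / (1 - Real.log t) := if_pos h1

theorem one_lt_logQuad {t : ℝ} (h1 : 1 < t) : 1 < logQuad t := by
  change 1 < logQuadFun t
  rw [logQuadFun, if_neg (not_le.2 h1)]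
  linarith

/-- The Orlicz function `t²`. -/
def quad : OrliczFunction where
  toFun := fun t => t ^ 2
  continuousOn' := (continuous_pow 2).continuousOn
  monotoneOn' := fun s hs t _ hst => pow_le_pow_left₀ hs hst 2
  convexOn' := convexOn_pow 2
  map_zero' := by norm_num
  tendsto' := tendsto_pow_atTop two_ne_zero
  nondegenerate' := fun t ht => (pow_pos ht 2).ne'

theorem quad_apply (t : ℝ) : quad t = t ^ 2 := rfl

theorem tendsto_rpow_nhdsGT_zero {r : ℝ} (hr : 0 < r) :
    Tendsto (fun t : ℝ => t ^ r) (𝓝[>] 0) (𝓝 0) := by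
  have := (Real.continuousAt_rpow_const 0 r (Or.inr hr.le)).tendsto
  rw [Real.zero_rpow hr.ne'] at this
  exact this.mono_left nhdsWithin_le_nhds

/-- The indices are both `2` if the quotients `M(st) / (M(s) t²)` lie between `1 / (1 - log t)`
and `1`. -/
theorem index_eq_two (M : OrliczFunction)
    (hup : ∀ s ∈ Ioc (0 : ℝ) 1, ∀ t ∈ Ioc (0 : ℝ) 1, M (s * t) / M s ≤ t ^ 2)
    (hlow : ∀ s ∈ Ioc (0 : ℝ) 1, ∀ t ∈ Ioc (0 : ℝ) 1,
      t ^ 2 / (1 - Real.log t) ≤ M (s * t) / M s) :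
    M.lowerIndex = 2 ∧ M.upperIndex = 2 := by
  have hev : ∀ᶠ t : ℝ in 𝓝[>] 0, t ∈ Ioc (0 : ℝ) 1 := Ioc_mem_nhdsGT one_pos
  -- The logarithm costs less than any power of `t`, hence does not move the indices.
  have hlog : ∀ t ∈ Ioc (0 : ℝ) 1, ∀ r > 0, 1 - Real.log t ≤ (1 + 1 / r) * t ^ (-r) := by
    intro t ht r hr
    have h1 : Real.log (t⁻¹) ≤ t⁻¹ ^ r / r := Real.log_le_rpow_div (by simp [ht.1.le]) hr
    rw [Real.log_inv, Real.inv_rpow ht.1.le, ← Real.rpow_neg ht.1.le] at h1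
    have h2 : 1 ≤ t ^ (-r) := Real.one_le_rpow_of_pos_of_le_one_of_nonpos ht.1 ht.2 (by linarith)
    calc 1 - Real.log t ≤ t ^ (-r) + t ^ (-r) / r := by linarith
      _ = _ := by ring
  have hdiv : ∀ t ∈ Ioc (0 : ℝ) 1, ∀ q : ℝ, t ^ 2 / t ^ q = t ^ (2 - q) := fun t ht q => by
    rw [Real.rpow_sub ht.1, Real.rpow_two]
  constructor
  · refine le_antisymm (sSup_le ?_) (le_sSup ⟨2, ⟨1, fun s hs t ht => ?_⟩, rfl⟩)
    · rintro _ ⟨q, ⟨C, hC⟩, rfl⟩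
      by_contra hq
      have hq' : 2 < q := by
        have := not_le.1 hq
        exact EReal.coe_lt_coe_iff.1 this
      -- Half of the excess: in `t ^ (q - 2) = t ^ r * t ^ r` one factor absorbs the logarithm and
      -- the other tends to `0`.
      set r := (q - 2) / 2 with hr
      have hr0 : 0 < r := by rw [hr]; linarith
      have hbd : ∀ᶠ t : ℝ in 𝓝[>] 0, 1 ≤ (1 + 1 / r) * C * t ^ r := by
        filter_upwards [hev] with t ht
        have h1 := hC 1 (by simp) t ht
        have hL : 0 < 1 - Real.log t := by linarith [one_le_one_sub_log ht.1.le ht.2]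
        rw [← div_div] at h1
        have htq := Real.rpow_pos_of_pos ht.1 q
        have h2 : t ^ 2 / (1 - Real.log t) / t ^ q ≤ C :=
          (div_le_div_of_nonneg_right (hlow 1 (by simp) t ht) htq.le).trans h1
        rw [div_right_comm, hdiv t ht, div_le_iff₀ hL] at h2
        have hC0 : 0 ≤ C := by
          by_contra hneg
          have := Real.rpow_pos_of_pos ht.1 (2 - q)
          nlinarith
        have h3 := h2.trans (mul_le_mul_of_nonneg_left (hlog t ht r hr0) hC0)
        have h4 := mul_le_mul_of_nonneg_right h3 (Real.rpow_nonneg ht.1.le (q - 2))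
        rw [← Real.rpow_add ht.1] at h4
        have h5 : t ^ (q - 2) = t ^ r * t ^ r := by
          rw [← Real.rpow_add ht.1]; congr 1; rw [hr]; ring
        have h6 : t ^ (-r) * t ^ r = 1 := by rw [← Real.rpow_add ht.1]; simp
        rw [show 2 - q + (q - 2) = 0 by ring, Real.rpow_zero, h5] at h4
        calc 1 ≤ _ := h4
          _ = (1 + 1 / r) * C * t ^ r * (t ^ (-r) * t ^ r) := by ring
          _ = _ := by rw [h6, mul_one]
      have := ge_of_tendsto ((tendsto_rpow_nhdsGT_zero hr0).const_mul ((1 + 1 / r) * C)) hbd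
      norm_num at this
    · rw [← div_div, Real.rpow_two]
      exact div_le_one_of_le₀ (hup s hs t ht) (sq_nonneg t)
  · refine le_antisymm ?_ (le_sInf ?_)
    -- The exponent `2` itself need not be admissible (it is not for `logQuad`), so the infimum is
    -- only approached.
    · have key : ∀ r : ℝ, 0 < r → M.upperIndex ≤ ((2 + r : ℝ) : EReal) := by
        intro r hr
        refine sInf_le ⟨2 + r, ⟨1 / (1 + 1 / r), by positivity, fun s hs t ht => ?_⟩, rfl⟩
        have hL : 0 < 1 - Real.log t := by linarith [one_le_one_sub_log ht.1.le ht.2]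
        have htq := Real.rpow_pos_of_pos ht.1 (2 + r)
        have h1 := div_le_div_of_nonneg_right (hlow s hs t ht) htq.le
        rw [div_right_comm, hdiv t ht, div_div (M (s * t))] at h1
        refine le_trans ?_ h1
        rw [show 2 - (2 + r) = -r by ring, div_le_div_iff₀ (by positivity) hL, one_mul, mul_comm]
        exact hlog t ht r hr
      refine EReal.le_of_forall_lt_iff_le.1 fun z hz => ?_
      have hz' : (2 : ℝ) < z := EReal.coe_lt_coe_iff.1 hz
      simpa using key (z - 2) (by linarith)
    · rintro _ ⟨q, ⟨c, hc, h⟩, rfl⟩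
      by_contra hq
      have hq' : q < 2 := by
        have := not_le.1 hq
        exact EReal.coe_lt_coe_iff.1 this
      have hbd : ∀ᶠ t : ℝ in 𝓝[>] 0, c ≤ t ^ (2 - q) := by
        filter_upwards [hev] with t ht
        refine (h 1 (by simp) t ht).trans ?_
        rw [← div_div, ← hdiv t ht]
        exact div_le_div_of_nonneg_right (hup 1 (by simp) t ht) (Real.rpow_nonneg ht.1.le q)
      have := ge_of_tendsto (tendsto_rpow_nhdsGT_zero (sub_pos.2 hq')) hbd
      linarith

theorem quad_index : quad.lowerIndex = 2 ∧ quad.upperIndex = 2 := by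
  have h : ∀ s ∈ Ioc (0 : ℝ) 1, ∀ t : ℝ, quad (s * t) / quad s = t ^ 2 := fun s hs t => by
    have := hs.1.ne'
    rw [quad_apply, quad_apply]
    field_simp
  refine index_eq_two _ (fun s hs t _ => (h s hs t).le) fun s hs t ht => ?_
  rw [h s hs t]
  exact div_le_self (sq_nonneg t) (one_le_one_sub_log ht.1.le ht.2)

/-- With `L = 1 - log s ≥ 1` the quotient is `t² L / (L - log t)`, and `L / (L - log t)` increases
in `L` from `1 / (1 - log t)` and stays below or at `1`. -/
theorem logQuad_index : logQuad.lowerIndex = 2 ∧ logQuad.upperIndex = 2 := by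
  have h : ∀ s ∈ Ioc (0 : ℝ) 1, ∀ t ∈ Ioc (0 : ℝ) 1, logQuad (s * t) / logQuad s =
      t ^ 2 * ((1 - Real.log s) / (1 - Real.log s - Real.log t)) := fun s hs t ht => by
    have h1 := one_le_one_sub_log hs.1.le hs.2
    have h2 := Real.log_nonpos ht.1.le ht.2
    have h3 : 1 - Real.log s ≠ 0 := by linarith
    have h4 : 1 - Real.log s - Real.log t ≠ 0 := by linarith
    have hs0 := hs.1.ne'
    rw [logQuad_apply hs.2, logQuad_apply (mul_le_one₀ hs.2 ht.1.le ht.2),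
      Real.log_mul hs.1.ne' ht.1.ne', ← sub_sub]
    field_simp
  refine index_eq_two _ (fun s hs t ht => ?_) fun s hs t ht => ?_ <;>
    rw [h s hs t ht] <;>
    have h1 := Real.log_nonpos hs.1.le hs.2 <;>
    have h2 := Real.log_nonpos ht.1.le ht.2
  · exact mul_le_of_le_one_right (sq_nonneg t) (div_le_one_of_le₀ (by linarith) (by linarith))
  · rw [div_eq_mul_one_div]
    refine mul_le_mul_of_nonneg_left ?_ (sq_nonneg t)
    rw [div_le_div_iff₀ (by linarith) (by linarith)]
    nlinarith

end OrliczFunction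
end

/-! ### Metric cotype on the discrete torus: complex values -/

noncomputable section

open scoped ComplexConjugate in
-- Parseval: by orthogonality of characters only the diagonal terms survive.
theorem AddChar.sum_norm_sq_sum_mul {G : Type*} [AddCommGroup G] [Fintype G]
    (d : AddChar G ℂ → ℂ) :
    ∑ x, ‖∑ ψ, d ψ * ψ x‖ ^ 2 = Fintype.card G * ∑ ψ, ‖d ψ‖ ^ 2 := by
  classical
  have key : ∀ ψ φ : AddChar G ℂ, ∑ x, ψ x * conj (φ x) =
      if ψ = φ then (Fintype.card G : ℂ) else 0 := by
    intro ψ φ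
    have h : ∀ x, ψ x * conj (φ x) = (ψ - φ) x := fun x => by
      rw [AddChar.sub_apply, AddChar.map_neg_eq_conj]
    simp_rw [h, AddChar.sum_eq_ite, sub_eq_zero]
  have hC : ((∑ x, ‖∑ ψ, d ψ * ψ x‖ ^ 2 : ℝ) : ℂ) =
      ((Fintype.card G * ∑ ψ, ‖d ψ‖ ^ 2 : ℝ) : ℂ) := by
    push_cast
    simp_rw [← Complex.mul_conj', map_sum, map_mul, Finset.sum_mul_sum]
    rw [Finset.sum_comm, Finset.mul_sum]
    refine Finset.sum_congr rfl fun ψ _ => ?_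
    rw [Finset.sum_comm]
    have : ∀ φ : AddChar G ℂ, ∑ x, d ψ * ψ x * (conj (d φ) * conj (φ x)) =
        d ψ * conj (d φ) * if ψ = φ then (Fintype.card G : ℂ) else 0 := fun φ => by
      rw [← key, Finset.mul_sum]
      exact Finset.sum_congr rfl fun x _ => by ring
    simp_rw [this]
    simp [mul_comm]
  exact_mod_cast hC

theorem AddChar.map_finsetSum {G ι : Type*} [AddCommMonoid G] (ψ : AddChar G ℂ) (s : Finset ι)
    (v : ι → G) : ψ (∑ i ∈ s, v i) = ∏ i ∈ s, ψ (v i) := by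
  classical
  induction s using Finset.induction_on with
  | empty => simp
  | insert i s hi ih => rw [Finset.sum_insert hi, Finset.prod_insert hi, map_add_eq_mul, ih]

/-- The squared increments of a function on a finite abelian group are a nonnegative combination
of those of its characters. -/
theorem exists_sum_norm_sq_sub_eq {G : Type*} [AddCommGroup G] [Fintype G] (g : G → ℂ) :
    ∃ w : AddChar G ℂ → ℝ, (∀ ψ, 0 ≤ w ψ) ∧
      ∀ h, ∑ x, ‖g (x + h) - g x‖ ^ 2 = ∑ ψ, w ψ * ‖ψ h - 1‖ ^ 2 := by
  classical
  set c := (AddChar.complexBasis G).repr g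
  have hg : ∀ x, g x = ∑ ψ, c ψ * ψ x := fun x => by
    have := congrFun ((AddChar.complexBasis G).sum_repr g) x
    simpa [Finset.sum_apply] using this.symm
  -- The increment along `h` has Fourier coefficients `c ψ * (ψ h - 1)`, so Parseval supplies the
  -- weights.
  refine ⟨fun ψ => Fintype.card G * ‖c ψ‖ ^ 2, fun ψ => by positivity, fun h => ?_⟩
  have : ∀ x, g (x + h) - g x = ∑ ψ, c ψ * (ψ h - 1) * ψ x := fun x => by
    rw [hg, hg, ← Finset.sum_sub_distrib]
    exact Finset.sum_congr rfl fun ψ _ => by rw [AddChar.map_add_eq_mul]; ring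
  simp_rw [this, AddChar.sum_norm_sq_sum_mul, Finset.mul_sum, norm_mul, mul_pow, mul_assoc]

/-- The vector of signs `±1` given by a sequence of booleans. -/
def signVector (n m : ℕ) (ε : Fin n → Bool) : Fin n → ZMod m := fun i => if ε i then 1 else -1

theorem norm_pow_sub_one_le {w : ℂ} (hw : ‖w‖ = 1) (k : ℕ) : ‖w ^ k - 1‖ ≤ k * ‖w - 1‖ := by
  induction k with
  | zero => simp
  | succ k ih =>
    calc ‖w ^ (k + 1) - 1‖ = ‖w ^ k * (w - 1) + (w ^ k - 1)‖ := by congr 1; ring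
      _ ≤ ‖w ^ k * (w - 1)‖ + ‖w ^ k - 1‖ := norm_add_le _ _
      _ ≤ ‖w - 1‖ + k * ‖w - 1‖ := by rw [norm_mul, norm_pow, hw, one_pow, one_mul]; gcongr
      _ = _ := by push_cast; ring

/-- The `k`-th power of `z²` lies at distance `2` from `1`, so `z²` lies at distance at least `2 /
k`; and `‖z² - 1‖² = 4 (1 - (re z)²)`. -/
theorem re_sq_le_of_pow_eq_neg_one {z : ℂ} (hz : ‖z‖ = 1) {k : ℕ} (hk : 0 < k)
    (h : z ^ (2 * k) = -1) : z.re ^ 2 ≤ 1 - 1 / (k : ℝ) ^ 2 := by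
  have h1 : ‖(z ^ 2) ^ k - 1‖ ≤ k * ‖z ^ 2 - 1‖ := norm_pow_sub_one_le (by simp [hz]) k
  rw [← pow_mul, h] at h1
  have h2 : ‖(-1 - 1 : ℂ)‖ = 2 := by norm_num
  rw [h2] at h1
  have h3 : z.re ^ 2 + z.im ^ 2 = 1 := by
    have := Complex.sq_norm z
    rw [hz, Complex.normSq_apply] at this
    linarith
  have h4 : ‖z ^ 2 - 1‖ ^ 2 = 4 * (1 - z.re ^ 2) := by
    rw [Complex.sq_norm, Complex.normSq_apply]
    simp only [pow_two, Complex.sub_re, Complex.mul_re, Complex.one_re, Complex.sub_im,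
      Complex.mul_im, Complex.one_im]
    have : z.im ^ 2 = 1 - z.re ^ 2 := by linarith
    linear_combination (z.im ^ 2 + z.re ^ 2 + 3) * this
  have hk' : (0 : ℝ) < k := by exact_mod_cast hk
  have h5 : (2 : ℝ) ^ 2 ≤ (k * ‖z ^ 2 - 1‖) ^ 2 := by gcongr
  rw [mul_pow, h4] at h5
  have : 1 / (k : ℝ) ^ 2 ≤ 1 - z.re ^ 2 := by
    rw [div_le_iff₀ (by positivity)]
    linarith
  linarith

theorem norm_sub_one_sq {w : ℂ} (hw : ‖w‖ = 1) : ‖w - 1‖ ^ 2 = 2 - 2 * w.re := by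
  have h := Complex.sq_norm w
  rw [hw, Complex.normSq_apply] at h
  rw [Complex.sq_norm, Complex.normSq_apply]
  simp only [Complex.sub_re, Complex.one_re, Complex.sub_im, Complex.one_im]
  linarith

/-- With `u = 1 / k²` and `v = r u ≤ 1`, Bernoulli and `(1 - u)(1 + u) ≤ 1` bound the left side by
`1 / (1 + v)`, and `(1 - v / 4)² (1 + v) ≥ 1` on `[0, 1]`. -/
theorem one_sub_pow_le {k r : ℕ} (hk : 0 < k) (hr : r ≤ k ^ 2) :
    (1 - 1 / (k : ℝ) ^ 2) ^ r ≤ (1 - r / (4 * k ^ 2)) ^ 2 := by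
  have hk' : (1 : ℝ) ≤ k := by exact_mod_cast hk
  have hr' : (r : ℝ) ≤ (k : ℝ) ^ 2 := by exact_mod_cast hr
  set u : ℝ := 1 / (k : ℝ) ^ 2 with hu
  have hu1 : u ≤ 1 := by rw [hu, div_le_one (by positivity)]; nlinarith
  have hu0 : 0 ≤ u := by positivity
  have hru : r * u ≤ 1 := by rw [hu, mul_one_div, div_le_one (by positivity)]; exact hr'
  have hq : (r : ℝ) / (4 * k ^ 2) = r * u / 4 := by rw [hu]; field_simp
  have hb : 1 + (r : ℝ) * u ≤ (1 + u) ^ r := one_add_mul_le_pow (by linarith) r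
  have h1 : (1 - u) ^ r * (1 + r * u) ≤ 1 := by
    calc (1 - u) ^ r * (1 + r * u) ≤ (1 - u) ^ r * (1 + u) ^ r :=
          mul_le_mul_of_nonneg_left hb (pow_nonneg (by linarith) _)
      _ = (1 - u ^ 2) ^ r := by rw [← mul_pow]; ring
      _ ≤ 1 := pow_le_one₀ (by nlinarith) (by nlinarith)
  have h0 : 0 ≤ (r : ℝ) * u := by positivity
  rw [hq]
  set v : ℝ := r * u
  have h2 : (1 - u) ^ r ≤ 1 / (1 + v) := by rwa [le_div_iff₀ (by linarith)]
  refine h2.trans ?_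
  rw [div_le_iff₀ (by linarith)]
  nlinarith [mul_nonneg h0 (sub_nonneg.2 hru), pow_nonneg h0 3]

/-- Let `z j` be the values of `ψ` at the unit vectors and `S` the set where `z j ^ (2k) = -1`;
elsewhere this power is `1`, so the sum on the left is `4 |S|`. The sign average of `‖ψ ε - 1‖²` is
`2 - 2 ∏ re (z j)`, which is at least `|S| / (2k²)` because each `j ∈ S` pushes the product away
from `1`. -/
theorem AddChar.sum_norm_sq_le {k : ℕ} (hk : 0 < k) (ψ : AddChar (Fin (k ^ 2) → ZMod (4 * k)) ℂ) :
    2 ^ (k ^ 2) * ∑ j, ‖ψ (Pi.single j ((2 * k : ℕ) : ZMod (4 * k))) - 1‖ ^ 2 ≤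
      8 * k ^ 2 * ∑ ε, ‖ψ (signVector (k ^ 2) (4 * k) ε) - 1‖ ^ 2 := by
  classical
  have : NeZero (4 * k) := ⟨by omega⟩
  have hk' : (0 : ℝ) < k := by exact_mod_cast hk
  set z : Fin (k ^ 2) → ℂ := fun j => ψ (Pi.single j 1) with hz
  have hn : ∀ j, ‖z j‖ = 1 := fun j => AddChar.norm_apply _ _
  have hz2 : ∀ j, ψ (Pi.single j ((2 * k : ℕ) : ZMod (4 * k))) = z j ^ (2 * k) := fun j => by
    rw [hz, ← AddChar.map_nsmul_eq_pow]
    congr 1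
    rw [← Pi.single_smul, nsmul_one]
  have hz4 : ∀ j, (z j ^ (2 * k)) ^ 2 = 1 := fun j => by
    rw [← pow_mul, hz, ← AddChar.map_nsmul_eq_pow]
    have : (2 * k * 2) • (Pi.single j 1 : Fin (k ^ 2) → ZMod (4 * k)) = 0 := by
      rw [← Pi.single_smul, nsmul_one, show 2 * k * 2 = 4 * k by ring, ZMod.natCast_self,
        Pi.single_zero]
    rw [this, AddChar.map_zero_eq_one]
  set S := Finset.univ.filter fun j => z j ^ (2 * k) = -1 with hS
  have hleft : ∑ j, ‖ψ (Pi.single j ((2 * k : ℕ) : ZMod (4 * k))) - 1‖ ^ 2 = 4 * S.card := by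
    have : ∀ j, ‖ψ (Pi.single j ((2 * k : ℕ) : ZMod (4 * k))) - 1‖ ^ 2 =
        if z j ^ (2 * k) = -1 then 4 else 0 := fun j => by
      rw [hz2]
      split_ifs with h
      · rw [h]; norm_num
      · rcases sq_eq_one_iff.1 (hz4 j) with h' | h'
        · rw [h']; simp
        · exact absurd h' h
    rw [Finset.sum_congr rfl fun j _ => this j, ← Finset.sum_filter, Finset.sum_const, ← hS]
    simp [mul_comm]
  have hprod : |∏ j, (z j).re| ≤ 1 - S.card / (4 * k ^ 2) := by
    -- The dimension `k²` is chosen to keep `|S|` within the range of `one_sub_pow_le`.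
    have hc : S.card ≤ k ^ 2 := by simpa using S.card_le_univ
    have hc' : (S.card : ℝ) / (4 * k ^ 2) ≤ 1 := by
      rw [div_le_one (by positivity)]
      have : (S.card : ℝ) ≤ (k : ℝ) ^ 2 := by exact_mod_cast hc
      nlinarith
    refine abs_le_of_sq_le_sq ?_ (sub_nonneg.2 hc')
    refine le_trans ?_ (one_sub_pow_le hk hc)
    rw [← Finset.prod_pow]
    calc ∏ j, (z j).re ^ 2 ≤ ∏ j, if z j ^ (2 * k) = -1 then (1 - 1 / (k : ℝ) ^ 2) else 1 := by
          refine Finset.prod_le_prod (fun j _ => sq_nonneg _) fun j _ => ?_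
          split_ifs with h
          · exact re_sq_le_of_pow_eq_neg_one (hn j) hk h
          · rw [sq_le_one_iff_abs_le_one, ← hn j]
            exact Complex.abs_re_le_norm _
      _ = _ := by rw [← Finset.prod_filter, Finset.prod_const]
  -- Independent signs factorise the sum, with factors `z j + conj (z j) = 2 re (z j)`.
  have hsum : ∑ ε, ψ (signVector (k ^ 2) (4 * k) ε) = ((2 ^ k ^ 2 * ∏ j, (z j).re : ℝ) : ℂ) := by
    have h1 : ∀ ε, ψ (signVector (k ^ 2) (4 * k) ε) =
        ∏ j, if ε j then z j else (starRingEnd ℂ) (z j) := fun ε => by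
      have : signVector (k ^ 2) (4 * k) ε =
          ∑ j, Pi.single j (if ε j then (1 : ZMod (4 * k)) else -1) :=
        (Finset.univ_sum_single _).symm
      rw [this, AddChar.map_finsetSum]
      refine Finset.prod_congr rfl fun j _ => ?_
      split_ifs
      · rfl
      · rw [Pi.single_neg, AddChar.map_neg_eq_conj]
    simp_rw [h1]
    have h2 := Finset.prod_univ_sum (fun _ : Fin (k ^ 2) => (Finset.univ : Finset Bool))
      (fun j b => if b then z j else (starRingEnd ℂ) (z j))
    rw [Fintype.piFinset_univ] at h2
    rw [← h2]
    push_cast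
    have h3 : ∀ j, ∑ b : Bool, (if b then z j else (starRingEnd ℂ) (z j)) = 2 * ((z j).re : ℂ) := by
      intro j
      simp [Complex.add_conj]
    simp_rw [h3, Finset.prod_mul_distrib]
    simp
  have hright : ∑ ε, ‖ψ (signVector (k ^ 2) (4 * k) ε) - 1‖ ^ 2 =
      2 ^ k ^ 2 * (2 - 2 * ∏ j, (z j).re) := by
    have h1 : ∀ ε, ‖ψ (signVector (k ^ 2) (4 * k) ε) - 1‖ ^ 2 =
        2 - 2 * (ψ (signVector (k ^ 2) (4 * k) ε)).re := fun ε =>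
      norm_sub_one_sq (AddChar.norm_apply _ _)
    simp_rw [h1]
    rw [Finset.sum_sub_distrib, ← Finset.mul_sum, ← Complex.re_sum, hsum, Complex.ofReal_re]
    simp
    ring
  rw [hleft, hright]
  have h2 := (le_abs_self _).trans hprod
  have h3 : (8 * (k : ℝ) ^ 2) * (2 * (S.card / (4 * k ^ 2))) = 4 * S.card := by
    field_simp; ring
  calc (2 : ℝ) ^ k ^ 2 * (4 * S.card) = 2 ^ k ^ 2 * ((8 * (k : ℝ) ^ 2) *
        (2 * (S.card / (4 * k ^ 2)))) := by rw [h3]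
    _ ≤ 2 ^ k ^ 2 * ((8 * (k : ℝ) ^ 2) * (2 - 2 * ∏ j, (z j).re)) := by gcongr; linarith
    _ = _ := by ring

/-- The metric cotype inequality for complex-valued functions on a discrete torus. -/
theorem metric_cotype_complex {k : ℕ} (hk : 0 < k) [NeZero (4 * k)]
    (g : (Fin (k ^ 2) → ZMod (4 * k)) → ℂ) :
    2 ^ (k ^ 2) * ∑ j, ∑ x, ‖g (x + Pi.single j ((2 * k : ℕ) : ZMod (4 * k))) - g x‖ ^ 2 ≤
      8 * k ^ 2 * ∑ ε, ∑ x, ‖g (x + signVector (k ^ 2) (4 * k) ε) - g x‖ ^ 2 := by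
  obtain ⟨w, hw, h⟩ := exists_sum_norm_sq_sub_eq g
  simp_rw [h]
  rw [Finset.sum_comm, Finset.sum_comm (f := fun ε ψ => w ψ * _), Finset.mul_sum, Finset.mul_sum]
  refine Finset.sum_le_sum fun ψ _ => ?_
  rw [← Finset.mul_sum, ← Finset.mul_sum, mul_left_comm, mul_left_comm _ (w ψ)]
  exact mul_le_mul_of_nonneg_left (AddChar.sum_norm_sq_le hk ψ) (hw ψ)
end

/-! ### Metric cotype on the discrete torus: from complex values to `ℓ_p` -/

noncomputable section
open MeasureTheory

/-- Near `0` the integrand is at most `a² t ^ (1 - p) / 2`, integrable as `p < 2`; near infinity it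
is at most `2 t ^ (-1 - p)`, integrable as `p > 0`. -/
theorem integrableOn_one_sub_cos_mul_rpow {p : ℝ} (h0 : 0 < p) (h2 : p < 2) (a : ℝ) :
    IntegrableOn (fun t : ℝ => (1 - Real.cos (t * a)) * t ^ (-1 - p)) (Ioi 0) := by
  have hcont : ContinuousOn (fun t : ℝ => (1 - Real.cos (t * a)) * t ^ (-1 - p)) (Ioi 0) := by
    refine ContinuousOn.mul (by fun_prop) fun t ht => ?_
    exact (Real.continuousAt_rpow_const t _ (Or.inl (ne_of_gt ht))).continuousWithinAt
  rw [← Ioc_union_Ioi_eq_Ioi zero_le_one]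
  refine IntegrableOn.union ?_ ?_
  · have h1 : IntegrableOn (fun t : ℝ => a ^ 2 / 2 * t ^ (1 - p)) (Ioc 0 1) := by
      have := (intervalIntegral.intervalIntegrable_rpow' (a := 0) (b := 1)
        (by linarith : -1 < 1 - p)).const_mul (a ^ 2 / 2)
      rwa [intervalIntegrable_iff_integrableOn_Ioc_of_le zero_le_one] at this
    refine h1.mono' ((hcont.mono Ioc_subset_Ioi_self).aestronglyMeasurable measurableSet_Ioc) ?_
    refine (ae_restrict_mem measurableSet_Ioc).mono fun t ht => ?_
    have hc := Real.cos_le_one (t * a)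
    have hq := Real.one_sub_sq_div_two_le_cos (x := t * a)
    have hp := Real.rpow_pos_of_pos ht.1 (-1 - p)
    rw [Real.norm_of_nonneg (mul_nonneg (by linarith) hp.le),
      show 1 - p = 2 + (-1 - p) by ring, Real.rpow_add ht.1, Real.rpow_two, ← mul_assoc]
    exact mul_le_mul_of_nonneg_right (by nlinarith) hp.le
  · have h1 : IntegrableOn (fun t : ℝ => 2 * t ^ (-1 - p)) (Ioi 1) :=
      (integrableOn_Ioi_rpow_of_lt (by linarith) one_pos).const_mul 2
    have hsub : Ioi (1 : ℝ) ⊆ Ioi 0 := Ioi_subset_Ioi zero_le_one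
    refine h1.mono' ((hcont.mono hsub).aestronglyMeasurable measurableSet_Ioi) ?_
    refine (ae_restrict_mem measurableSet_Ioi).mono fun t ht => ?_
    have hc := Real.cos_le_one (t * a)
    have hq := Real.neg_one_le_cos (t * a)
    have hp := Real.rpow_pos_of_pos (hsub ht) (-1 - p)
    rw [Real.norm_of_nonneg (mul_nonneg (by linarith) hp.le)]
    exact mul_le_mul_of_nonneg_right (by linarith) hp.le

/-- Rescale `t` by `|a|`. Thus `|a| ^ p` is a positive mixture of the kernels `1 - cos (ta)`, which
are squared distances on the unit circle. -/
theorem integral_one_sub_cos_mul_rpow {p : ℝ} (h0 : 0 < p) (a : ℝ) :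
    ∫ t in Ioi (0 : ℝ), (1 - Real.cos (t * a)) * t ^ (-1 - p) =
      |a| ^ p * ∫ t in Ioi (0 : ℝ), (1 - Real.cos t) * t ^ (-1 - p) := by
  rcases eq_or_ne a 0 with rfl | ha
  · simp [Real.zero_rpow h0.ne']
  have ha' : 0 < |a| := abs_pos.2 ha
  have h := integral_comp_mul_left_Ioi (fun t : ℝ => (1 - Real.cos t) * t ^ (-1 - p)) 0 ha'
  rw [mul_zero, smul_eq_mul] at h
  have h1 : ∫ t in Ioi (0 : ℝ), (1 - Real.cos (|a| * t)) * (|a| * t) ^ (-1 - p) =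
      |a| ^ (-1 - p) * ∫ t in Ioi (0 : ℝ), (1 - Real.cos (t * a)) * t ^ (-1 - p) := by
    rw [← integral_const_mul]
    refine setIntegral_congr_fun measurableSet_Ioi fun t ht => ?_
    have hcos : Real.cos (|a| * t) = Real.cos (t * a) := by
      rw [← Real.cos_abs (t * a), abs_mul, abs_of_pos (mem_Ioi.1 ht), mul_comm]
    simp only [hcos]
    rw [Real.mul_rpow ha'.le (le_of_lt ht)]
    ring
  rw [h1] at h
  have h2 : |a| ^ (1 + p) * |a| ^ (-1 - p) = 1 := by
    rw [← Real.rpow_add ha']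
    simp
  calc _ = |a| ^ (1 + p) * (|a| ^ (-1 - p) *
        ∫ t in Ioi (0 : ℝ), (1 - Real.cos (t * a)) * t ^ (-1 - p)) := by
          rw [← mul_assoc, h2, one_mul]
    _ = _ := by
      rw [h, Real.rpow_add ha', Real.rpow_one]
      field_simp

theorem integral_one_sub_cos_mul_rpow_pos {p : ℝ} (h0 : 0 < p) (h2 : p < 2) :
    0 < ∫ t in Ioi (0 : ℝ), (1 - Real.cos t) * t ^ (-1 - p) := by
  have hint : IntegrableOn (fun t : ℝ => (1 - Real.cos t) * t ^ (-1 - p)) (Ioi 0) := by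
    simpa using integrableOn_one_sub_cos_mul_rpow h0 h2 1
  have hnn : ∀ t ∈ Ioi (0 : ℝ), 0 ≤ (1 - Real.cos t) * t ^ (-1 - p) := fun t ht =>
    mul_nonneg (by linarith [Real.cos_le_one t]) (Real.rpow_nonneg (le_of_lt ht) _)
  rw [setIntegral_pos_iff_support_of_nonneg_ae
    ((ae_restrict_mem measurableSet_Ioi).mono hnn) hint]
  have hsub : Ioo (0 : ℝ) 1 ⊆
      Function.support (fun t : ℝ => (1 - Real.cos t) * t ^ (-1 - p)) ∩ Ioi 0 := by
    intro t ht
    refine ⟨?_, ht.1⟩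
    have : Real.cos t < 1 := by
      rw [← Real.cos_zero]
      exact Real.cos_lt_cos_of_nonneg_of_le_pi le_rfl (by linarith [ht.2, Real.pi_gt_three]) ht.1
    exact mul_ne_zero (by linarith) (Real.rpow_pos_of_pos ht.1 _).ne'
  refine lt_of_lt_of_le ?_ (measure_mono hsub)
  simp

theorem norm_exp_mul_I_sub_sq (a b : ℝ) :
    ‖Complex.exp (a * Complex.I) - Complex.exp (b * Complex.I)‖ ^ 2 =
      2 * (1 - Real.cos (a - b)) := by
  have h : Complex.exp (a * Complex.I) - Complex.exp (b * Complex.I) =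
      Complex.exp (b * Complex.I) * (Complex.exp ((a - b : ℝ) * Complex.I) - 1) := by
    rw [mul_sub, ← Complex.exp_add, mul_one]
    congr 2
    push_cast
    ring
  rw [h, norm_mul, Complex.norm_exp_ofReal_mul_I, one_mul,
    norm_sub_one_sq (Complex.norm_exp_ofReal_mul_I _), Complex.exp_ofReal_mul_I_re]
  ring

/-- The metric cotype inequality for real-valued functions and the kernel `|a - b| ^ p`. -/
theorem metric_cotype_real {p : ℝ} (h0 : 0 < p) (h2 : p ≤ 2) {k : ℕ} (hk : 0 < k) [NeZero (4 * k)]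
    (g : (Fin (k ^ 2) → ZMod (4 * k)) → ℝ) :
    2 ^ (k ^ 2) * ∑ j, ∑ x, |g (x + Pi.single j ((2 * k : ℕ) : ZMod (4 * k))) - g x| ^ p ≤
      8 * k ^ 2 * ∑ ε, ∑ x, |g (x + signVector (k ^ 2) (4 * k) ε) - g x| ^ p := by
  -- At `p = 2` the integral representation diverges, but the complex inequality applies directly.
  rcases h2.eq_or_lt with rfl | h2
  · have := metric_cotype_complex hk fun x => (g x : ℂ)
    simpa only [← Complex.ofReal_sub, Complex.norm_real, Real.norm_eq_abs, Real.rpow_two] using this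
  set c := ∫ t in Ioi (0 : ℝ), (1 - Real.cos t) * t ^ (-1 - p) with hc
  have hc0 : 0 < c := integral_one_sub_cos_mul_rpow_pos h0 h2
  have hint := fun a : ℝ => integrableOn_one_sub_cos_mul_rpow h0 h2 a
  refine le_of_mul_le_mul_right ?_ hc0
  rw [mul_assoc, mul_assoc]
  simp_rw [Finset.sum_mul, hc, ← integral_one_sub_cos_mul_rpow h0]
  simp_rw [← integral_finsetSum Finset.univ fun x _ => hint _]
  rw [← integral_finsetSum, ← integral_finsetSum, ← integral_const_mul, ← integral_const_mul]
  rotate_left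
  · exact fun _ _ => integrable_finsetSum _ fun _ _ => hint _
  · exact fun _ _ => integrable_finsetSum _ fun _ _ => hint _
  refine setIntegral_mono_on ?_ ?_ measurableSet_Ioi fun t ht => ?_
  · exact (integrable_finsetSum _ fun _ _ => integrable_finsetSum _ fun _ _ => hint _).const_mul _
  · exact (integrable_finsetSum _ fun _ _ => integrable_finsetSum _ fun _ _ => hint _).const_mul _
  -- For each frequency `t` the inequality holds for the circle-valued map `exp (i t g)`.
  · have h := metric_cotype_complex hk fun x => Complex.exp ((t * g x : ℝ) * Complex.I)
    simp_rw [norm_exp_mul_I_sub_sq, ← Finset.mul_sum, ← mul_sub] at h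
    simp_rw [← Finset.sum_mul, ← mul_assoc]
    refine mul_le_mul_of_nonneg_right ?_ (Real.rpow_nonneg (le_of_lt ht) _)
    linarith

/-- The metric cotype inequality for `ℓ_p`-valued functions, `p ≤ 2`. -/
theorem metric_cotype_lp {p : ℝ≥0∞} [Fact (1 ≤ p)] (h2 : p ≤ 2) {k : ℕ} (hk : 0 < k)
    [NeZero (4 * k)] (g : (Fin (k ^ 2) → ZMod (4 * k)) → RealEllP p) :
    2 ^ (k ^ 2) * ∑ j, ∑ x,
        ‖g (x + Pi.single j ((2 * k : ℕ) : ZMod (4 * k))) - g x‖ ^ p.toReal ≤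
      8 * k ^ 2 * ∑ ε, ∑ x, ‖g (x + signVector (k ^ 2) (4 * k) ε) - g x‖ ^ p.toReal := by
  have hp : p ≠ ∞ := ne_top_of_le_ne_top (by norm_num) h2
  have h1 : 1 ≤ p.toReal := by
    simpa using ENNReal.toReal_mono hp (Fact.out : 1 ≤ p)
  have h2' : p.toReal ≤ 2 := by simpa using ENNReal.toReal_mono (by norm_num) h2
  have h0 : 0 < p.toReal := by linarith
  have hs : ∀ u v : RealEllP p, HasSum (fun i => |u i - v i| ^ p.toReal) (‖u - v‖ ^ p.toReal) :=
    fun u v => lp.hasSum_norm h0 (u - v)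
  have hL := (hasSum_sum (s := Finset.univ) fun j _ => hasSum_sum (s := Finset.univ) fun x _ =>
    hs (g (x + Pi.single j ((2 * k : ℕ) : ZMod (4 * k)))) (g x)).mul_left ((2 : ℝ) ^ (k ^ 2))
  have hR := (hasSum_sum (s := Finset.univ) fun ε _ => hasSum_sum (s := Finset.univ) fun x _ =>
    hs (g (x + signVector (k ^ 2) (4 * k) ε)) (g x)).mul_left (8 * (k : ℝ) ^ 2)
  exact hasSum_le (fun i => metric_cotype_real h0 h2' hk fun x => g x i) hL hR

/-- If all short edges of a torus have images of diameter at most `b` and all long edges have images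
of diameter at least `a`, then `a ≤ 8 b`. -/
theorem le_mul_of_torus {p : ℝ≥0∞} [Fact (1 ≤ p)] (h2 : p ≤ 2) {k : ℕ} (hk : 0 < k)
    [NeZero (4 * k)] (g : (Fin (k ^ 2) → ZMod (4 * k)) → RealEllP p) {a b : ℝ} (ha0 : 0 ≤ a)
    (ha : ∀ x j, a ≤ dist (g (x + Pi.single j ((2 * k : ℕ) : ZMod (4 * k)))) (g x))
    (hb : ∀ x ε, dist (g (x + signVector (k ^ 2) (4 * k) ε)) (g x) ≤ b) :
    a ≤ 8 * b := by
  have h := metric_cotype_lp h2 hk g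
  have hL : (∑ _j : Fin (k ^ 2), ∑ _x : Fin (k ^ 2) → ZMod (4 * k), a ^ p.toReal) ≤ ∑ j, ∑ x,
      ‖g (x + Pi.single j ((2 * k : ℕ) : ZMod (4 * k))) - g x‖ ^ p.toReal := by
    refine Finset.sum_le_sum fun j _ => Finset.sum_le_sum fun x _ => ?_
    have := ha x j
    rw [dist_eq_norm] at this
    gcongr
  have hR : ∑ ε, ∑ x, ‖g (x + signVector (k ^ 2) (4 * k) ε) - g x‖ ^ p.toReal ≤
      ∑ _ε : Fin (k ^ 2) → Bool, ∑ _x : Fin (k ^ 2) → ZMod (4 * k), b ^ p.toReal := by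
    refine Finset.sum_le_sum fun j _ => Finset.sum_le_sum fun x _ => ?_
    have := hb x j
    rw [dist_eq_norm] at this
    gcongr
  have h' := (mul_le_mul_of_nonneg_left hL (by positivity)).trans
    (h.trans (mul_le_mul_of_nonneg_left hR (by positivity)))
  simp only [Finset.sum_const, Finset.card_univ, nsmul_eq_mul, Fintype.card_fun, Fintype.card_bool,
    Fintype.card_fin] at h'
  have hk' : (0 : ℝ) < k := by exact_mod_cast hk
  -- The factor common to both sides: `k²` long edges per point with prefactor `2 ^ (k²)`, against
  -- `2 ^ (k²)` sign vectors per point with prefactor `8 k²`.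
  have hpos : (0 : ℝ) < 2 ^ k ^ 2 * k ^ 2 * (Fintype.card (ZMod (4 * k)) ^ k ^ 2 : ℕ) := by
    have : 0 < Fintype.card (ZMod (4 * k)) := Fintype.card_pos
    positivity
  have h1 : 1 ≤ p.toReal := by
    simpa using ENNReal.toReal_mono (ne_top_of_le_ne_top (by norm_num) h2) (Fact.out : 1 ≤ p)
  have hb0 : 0 ≤ b := dist_nonneg.trans (hb 0 fun _ => true)
  have hab : a ^ p.toReal ≤ 8 * b ^ p.toReal := by
    refine le_of_mul_le_mul_left ?_ hpos
    push_cast at h' ⊢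
    linarith
  rw [← Real.rpow_le_rpow_iff ha0 (by positivity) (by linarith : 0 < p.toReal),
    Real.mul_rpow (by norm_num) hb0]
  refine hab.trans (mul_le_mul_of_nonneg_right ?_ (Real.rpow_nonneg hb0 _))
  exact Real.self_le_rpow_of_one_le (by norm_num) h1
end

/-! ### Tori in `h_M` and nonembeddability -/

noncomputable section
namespace OrliczFunction

variable (M : OrliczFunction)

theorem nonneg {t : ℝ} (ht : 0 ≤ t) : 0 ≤ M t := by
  have := M.monotoneOn' (mem_Ici.2 le_rfl) (mem_Ici.2 ht) ht
  rwa [M.map_zero'] at this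

theorem modular_eq_sum {f : ℕ → ℝ} {N : ℕ} (hf : ∀ i, N ≤ i → f i = 0) (ρ : ℝ) :
    M.modular f ρ = ∑ i ∈ Finset.range N, ENNReal.ofReal (M (|f i| / ρ)) := by
  refine tsum_eq_sum fun i hi => ?_
  rw [hf i (by simpa using hi), abs_zero, zero_div, M.map_zero', ENNReal.ofReal_zero]

/-- A sequence that vanishes from some index on, as an element of `h_M`. -/
def ofEventuallyZero (f : ℕ → ℝ) (hf : ∃ N, ∀ i, N ≤ i → f i = 0) : M.h :=
  have h : ∀ ρ, M.modular f ρ < ∞ := fun ρ => by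
    obtain ⟨N, hN⟩ := hf
    rw [M.modular_eq_sum hN]
    exact ENNReal.sum_lt_top.2 fun _ _ => ENNReal.ofReal_lt_top
  ⟨⟨f, 1, one_pos, h 1⟩, fun ρ _ => h ρ⟩

theorem norm_le_of_abs_le {x : M.Ell} {N : ℕ} (hx : ∀ i, N ≤ i → x.seq i = 0) {b ρ : ℝ}
    (hρ : 0 < ρ) (hb : ∀ i, |x.seq i| ≤ b) (h : N * M (b / ρ) ≤ 1) : ‖x‖ ≤ ρ := by
  refine M.norm_le_of hρ ?_
  rw [M.modular_eq_sum hx]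
  have hb0 : 0 ≤ b := (abs_nonneg _).trans (hb 0)
  calc ∑ i ∈ Finset.range N, ENNReal.ofReal (M (|x.seq i| / ρ))
      ≤ ∑ i ∈ Finset.range N, ENNReal.ofReal (M (b / ρ)) := by
        refine Finset.sum_le_sum fun i _ => ENNReal.ofReal_le_ofReal ?_
        refine M.monotoneOn' (mem_Ici.2 (by positivity)) (mem_Ici.2 (by positivity)) ?_
        gcongr
        exact hb i
    _ = ENNReal.ofReal (N * M (b / ρ)) := by
        rw [Finset.sum_const, Finset.card_range, nsmul_eq_mul,
          ENNReal.ofReal_mul (Nat.cast_nonneg N), ENNReal.ofReal_natCast]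
    _ ≤ 1 := ENNReal.ofReal_le_one.2 h

/-- A single coordinate exceeding `σ > ‖x‖` would already make the modular at `σ` exceed `1`. -/
theorem abs_seq_le_norm (hM : ∀ t, 1 < t → 1 < M t) (x : M.Ell) (i : ℕ) : |x.seq i| ≤ ‖x‖ := by
  refine le_of_forall_gt fun ρ hρ => ?_
  by_contra! hlt
  obtain ⟨σ, h1, h2⟩ := exists_between hρ
  obtain ⟨hσ, h⟩ := M.modular_le_one h1
  have h3 := (ENNReal.le_tsum i).trans h
  rw [ENNReal.ofReal_le_one] at h3
  have := hM (|x.seq i| / σ) (by rw [one_lt_div hσ]; linarith)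
  linarith

theorem seq_sub (x y : M.Ell) (i : ℕ) : (x - y).seq i = x.seq i - y.seq i := rfl

theorem seq_ofEventuallyZero (f : ℕ → ℝ) (hf : ∃ N, ∀ i, N ≤ i → f i = 0) :
    (M.ofEventuallyZero f hf).1.seq = f := rfl

theorem dist_h_eq (x y : M.h) : dist x y = ‖x.1 - y.1‖ := by
  rw [Subtype.dist_eq, dist_eq_norm]

end OrliczFunction

/-- The chord is at most the arc `π / (2k)`, and `π ≤ 4`. -/
theorem norm_stdAddChar_one_sub_one_le {k : ℕ} (hk : 0 < k) [NeZero (4 * k)] :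
    ‖ZMod.stdAddChar (1 : ZMod (4 * k)) - 1‖ ≤ 2 / k := by
  have hk' : (0 : ℝ) < k := by exact_mod_cast hk
  have h := ZMod.stdAddChar_coe (N := 4 * k) 1
  have h2 : (2 * Real.pi * Complex.I * ((1 : ℤ) : ℂ) / ((4 * k : ℕ) : ℂ) : ℂ) =
      Complex.I * ((Real.pi / (2 * k) : ℝ) : ℂ) := by
    have : (k : ℂ) ≠ 0 := by exact_mod_cast hk.ne'
    push_cast
    field_simp
    ring
  rw [h2, Int.cast_one] at h
  rw [h]
  refine Real.norm_exp_I_mul_ofReal_sub_one_le.trans ?_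
  rw [Real.norm_of_nonneg (by positivity), div_le_div_iff₀ (by positivity) hk']
  nlinarith [Real.pi_le_four]

theorem stdAddChar_half {k : ℕ} (hk : 0 < k) [NeZero (4 * k)] :
    ZMod.stdAddChar ((2 * k : ℕ) : ZMod (4 * k)) = -1 := by
  have h := ZMod.stdAddChar_coe (N := 4 * k) (2 * k : ℕ)
  rw [Int.cast_natCast] at h
  rw [h, ← Complex.exp_pi_mul_I]
  congr 1
  have : (k : ℂ) ≠ 0 := by exact_mod_cast hk.ne'
  push_cast
  field_simp
  ring

theorem norm_stdAddChar_sign_sub_one_le {k : ℕ} (hk : 0 < k) [NeZero (4 * k)] (b : Bool) :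
    ‖ZMod.stdAddChar (if b then (1 : ZMod (4 * k)) else -1) - 1‖ ≤ 2 / k := by
  cases b
  · have h : ZMod.stdAddChar (-1 : ZMod (4 * k)) - 1 =
        (starRingEnd ℂ) (ZMod.stdAddChar (1 : ZMod (4 * k)) - 1) := by
      rw [AddChar.map_neg_eq_conj, map_sub, map_one (starRingEnd ℂ)]
    simp only [Bool.false_eq_true, if_false]
    rw [h, RCLike.norm_conj]
    exact norm_stdAddChar_one_sub_one_le hk
  · exact norm_stdAddChar_one_sub_one_le hk

/-- The real and imaginary parts of the points of a discrete torus of radius `R`, interlaced. -/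
def torusSeq {n m : ℕ} [NeZero m] (R : ℝ) (x : Fin n → ZMod m) (i : ℕ) : ℝ :=
  if h : i / 2 < n then
    R * if i % 2 = 0 then (ZMod.stdAddChar (x ⟨i / 2, h⟩)).re
      else (ZMod.stdAddChar (x ⟨i / 2, h⟩)).im
  else 0

theorem torusSeq_eq_zero {n m : ℕ} [NeZero m] (R : ℝ) (x : Fin n → ZMod m) (i : ℕ)
    (hi : 2 * n ≤ i) : torusSeq R x i = 0 :=
  dif_neg (by omega)

theorem abs_torusSeq_sub_le {k : ℕ} (hk : 0 < k) [NeZero (4 * k)] {R : ℝ} (hR : 0 ≤ R)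
    (x : Fin (k ^ 2) → ZMod (4 * k)) (ε : Fin (k ^ 2) → Bool) (i : ℕ) :
    |torusSeq R (x + signVector _ _ ε) i - torusSeq R x i| ≤ 2 * R / k := by
  unfold torusSeq
  split_ifs with h
  all_goals try (simp; positivity)
  all_goals
    set j : Fin (k ^ 2) := ⟨i / 2, h⟩
    have hd : ‖ZMod.stdAddChar ((x + signVector _ _ ε : Fin (k ^ 2) → ZMod (4 * k)) j) - ZMod.stdAddChar (x j)‖ ≤ 2 / k := by
      rw [Pi.add_apply, AddChar.map_add_eq_mul, ← mul_sub_one, norm_mul, AddChar.norm_apply,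
        one_mul]
      exact norm_stdAddChar_sign_sub_one_le hk (ε j)
    rw [← mul_sub, abs_mul, abs_of_nonneg hR, mul_comm 2 R, mul_div_assoc]
    refine mul_le_mul_of_nonneg_left (le_trans ?_ hd) hR
  · rw [← Complex.sub_re]
    exact Complex.abs_re_le_norm _
  · rw [← Complex.sub_im]
    exact Complex.abs_im_le_norm _

/-- Half a period sends `z` to `-z`, moving its real and imaginary parts by twice their size; one of
the two has size at least `1 / 2`. -/
theorem exists_le_abs_torusSeq_sub {k : ℕ} (hk : 0 < k) [NeZero (4 * k)] {R : ℝ} (hR : 0 ≤ R)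
    (x : Fin (k ^ 2) → ZMod (4 * k)) (j : Fin (k ^ 2)) :
    ∃ i, R ≤ |torusSeq R (x + Pi.single j ((2 * k : ℕ) : ZMod (4 * k))) i - torusSeq R x i| := by
  set z : ℂ := ZMod.stdAddChar (x j) with hz
  have hadd : ZMod.stdAddChar ((x + Pi.single j ((2 * k : ℕ) : ZMod (4 * k)) :
      Fin (k ^ 2) → ZMod (4 * k)) j) = -z := by
    rw [Pi.add_apply, Pi.single_eq_same, AddChar.map_add_eq_mul, stdAddChar_half hk, mul_neg_one]
  have hn : z.re ^ 2 + z.im ^ 2 = 1 := by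
    have h := Complex.sq_norm z
    rw [hz, AddChar.norm_apply, ← hz, Complex.normSq_apply] at h
    linarith
  have hfin : ∀ i : ℕ, i / 2 = (j : ℕ) → ∃ h : i / 2 < k ^ 2, (⟨i / 2, h⟩ : Fin (k ^ 2)) = j := fun i hi =>
    ⟨by omega, Fin.ext hi⟩
  rcases le_total (1 / 2) |z.re| with hre | hre
  · refine ⟨2 * j, ?_⟩
    obtain ⟨h, hj⟩ := hfin (2 * j) (by omega)
    have hmod : 2 * (j : ℕ) % 2 = 0 := by omega
    rw [torusSeq, torusSeq, dif_pos h, dif_pos h, if_pos hmod, if_pos hmod, hj, hadd, ← hz,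
      Complex.neg_re, ← mul_sub, abs_mul, abs_of_nonneg hR, ← neg_add', abs_neg, ← two_mul,
      abs_mul, abs_two]
    exact le_mul_of_one_le_right hR (by linarith)
  · refine ⟨2 * j + 1, ?_⟩
    obtain ⟨h, hj⟩ := hfin (2 * j + 1) (by omega)
    have hmod : ¬ (2 * (j : ℕ) + 1) % 2 = 0 := by omega
    have him : 1 / 2 ≤ |z.im| := by
      refine abs_le_of_sq_le_sq' ?_ (abs_nonneg _) |>.2
      have := pow_le_pow_left₀ (abs_nonneg _) hre 2
      rw [sq_abs] at this ⊢
      linarith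
    rw [torusSeq, torusSeq, dif_pos h, dif_pos h, if_neg hmod, if_neg hmod, hj, hadd, ← hz,
      Complex.neg_im, ← mul_sub, abs_mul, abs_of_nonneg hR, ← neg_add', abs_neg, ← two_mul,
      abs_mul, abs_two]
    exact le_mul_of_one_le_right hR (by linarith)

/-- With `c = 2R / ρ`, the modular of a sign move at `ρ` is at most `2k² M(c / k) = 2c² / (1 - log
(c / k))`, which tends to `0` as `k` grows. For `t²` this bound would be `2c²` for every `k`. -/
theorem exists_torus_logQuad {R ρ : ℝ} (hR : 0 < R) (hρ : 0 < ρ) :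
    ∃ (k : ℕ) (_ : 0 < k) (_ : NeZero (4 * k))
      (F : (Fin (k ^ 2) → ZMod (4 * k)) → OrliczFunction.logQuad.h),
      (∀ x j, R ≤ dist (F (x + Pi.single j ((2 * k : ℕ) : ZMod (4 * k)))) (F x)) ∧
      ∀ x ε, dist (F (x + signVector _ _ ε)) (F x) ≤ ρ := by
  set c : ℝ := 2 * R / ρ with hc
  have hc0 : 0 < c := by positivity
  -- This `k` gives `-log (c / k) ≥ 2c²`, so the modular is at most `1`, and also `c / k ≤ 1`, where
  -- the formula for `M` is valid.
  obtain ⟨k, hkc⟩ := exists_nat_ge (c * Real.exp (2 * c ^ 2))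
  have hk' : (0 : ℝ) < k := lt_of_lt_of_le (by positivity) hkc
  have hk : 0 < k := by exact_mod_cast hk'
  have hne : NeZero (4 * k) := ⟨by omega⟩
  have hzero : ∀ x : Fin (k ^ 2) → ZMod (4 * k), ∀ i, 2 * k ^ 2 ≤ i → torusSeq R x i = 0 :=
    fun x => torusSeq_eq_zero R x
  let F : (Fin (k ^ 2) → ZMod (4 * k)) → OrliczFunction.logQuad.h := fun x =>
    OrliczFunction.logQuad.ofEventuallyZero (torusSeq R x) ⟨_, hzero x⟩
  refine ⟨k, hk, hne, F, fun x j => ?_, fun x ε => ?_⟩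
  · obtain ⟨i, hi⟩ := exists_le_abs_torusSeq_sub hk hR.le x j
    rw [OrliczFunction.dist_h_eq]
    refine le_trans ?_ (OrliczFunction.abs_seq_le_norm _
      (fun t => OrliczFunction.one_lt_logQuad) _ i)
    rwa [OrliczFunction.seq_sub, OrliczFunction.seq_ofEventuallyZero,
      OrliczFunction.seq_ofEventuallyZero]
  · have hseq : ∀ i, ((F (x + signVector _ _ ε)).1 - (F x).1).seq i =
        torusSeq R (x + signVector _ _ ε) i - torusSeq R x i := fun i => by
      rw [OrliczFunction.seq_sub, OrliczFunction.seq_ofEventuallyZero,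
        OrliczFunction.seq_ofEventuallyZero]
    rw [OrliczFunction.dist_h_eq]
    refine OrliczFunction.norm_le_of_abs_le _ (N := 2 * k ^ 2) (b := 2 * R / k) (fun i hi => ?_)
      hρ (fun i => ?_) ?_
    · rw [hseq, hzero _ i hi, hzero _ i hi, sub_zero]
    · rw [hseq]
      exact abs_torusSeq_sub_le hk hR.le x ε i
    · have hck : 2 * R / k / ρ = c / k := by rw [hc]; field_simp
      have hexp : 1 ≤ Real.exp (2 * c ^ 2) := Real.one_le_exp (by positivity)
      have hck1 : c / k ≤ 1 := by
        rw [div_le_one hk']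
        nlinarith
      have hlog : 2 * c ^ 2 ≤ -Real.log (c / k) := by
        rw [← Real.log_inv, Real.le_log_iff_exp_le (by positivity), inv_div, le_div_iff₀ hc0,
          mul_comm]
        exact hkc
      have hpos : 0 < 1 - Real.log (c / k) := by nlinarith
      rw [hck, OrliczFunction.logQuad_apply hck1, ← mul_div_assoc, div_le_one hpos]
      push_cast
      have : 2 * (k : ℝ) ^ 2 * (c / k) ^ 2 = 2 * c ^ 2 := by field_simp
      linarith

theorem not_coarselyEmbeds_logQuad (p : ℝ≥0∞) [Fact (1 ≤ p)] (hp : p ≤ 2) :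
    ¬ CoarselyEmbeds OrliczFunction.logQuad.h (RealEllP p) := by
  rintro ⟨f, ρ₁, ρ₂, h₁, h₂, hlim, hf⟩
  -- Sign moves are kept at length at most `1`; a radius `T` with `ρ₁ T > 8 ρ₂ 1` contradicts
  -- `le_mul_of_torus`.
  obtain ⟨T, hT, hT0⟩ := ((hlim.eventually_gt_atTop (8 * ρ₂ 1)).and (eventually_gt_atTop 0)).exists
  obtain ⟨k, hk, hne, F, hlong, hshort⟩ := exists_torus_logQuad (R := T) (ρ := 1) hT0 one_pos
  have h := le_mul_of_torus hp hk (fun x => f (F x)) (a := ρ₁ T) (b := ρ₂ 1) (ρ₁ T).2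
    (fun x j => ?_) (fun x ε => ?_)
  · exact absurd hT (not_lt.2 (by exact_mod_cast h))
  · rw [← coe_nndist, NNReal.coe_le_coe]
    refine (h₁ ?_).trans (hf _ _).1
    rw [← NNReal.coe_le_coe, coe_nndist]
    exact hlong x j
  · rw [← coe_nndist, NNReal.coe_le_coe]
    refine (hf _ _).2.trans (h₂ ?_)
    rw [← NNReal.coe_le_coe, coe_nndist]
    exact hshort x ε

theorem not_uniformlyEmbeds_logQuad (p : ℝ≥0∞) [Fact (1 ≤ p)] (hp : p ≤ 2) :
    ¬ UniformlyEmbeds OrliczFunction.logQuad.h (RealEllP p) := by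
  rintro ⟨f, hf⟩
  obtain ⟨-, hcont, hinv⟩ := Metric.isUniformEmbedding_iff.1 hf
  obtain ⟨a, ha, hinv⟩ := hinv 1 one_pos
  -- Any fraction of `a` below `1 / 8` contradicts `a ≤ 8 b`.
  obtain ⟨δ, hδ, hcont⟩ := Metric.uniformContinuous_iff.1 hcont (a / 9) (by positivity)
  obtain ⟨k, hk, hne, F, hlong, hshort⟩ := exists_torus_logQuad (R := 1) (ρ := δ / 2) one_pos
    (half_pos hδ)
  have h := le_mul_of_torus hp hk (fun x => f (F x)) (a := a) (b := a / 9) ha.le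
    (fun x j => ?_) (fun x ε => ?_)
  · linarith
  · by_contra! hlt
    exact absurd (hinv hlt) (not_lt.2 (hlong x j))
  · exact (hcont ((hshort x ε).trans_lt (half_lt_self hδ))).le
end

/-! ### The Mazur map -/

noncomputable section

/-- The signed power `sgn(a) |a| ^ (1 + s)`. -/
def signedPow (s a : ℝ) : ℝ := a * |a| ^ s

theorem signedPow_neg (s a : ℝ) : signedPow s (-a) = -signedPow s a := by
  simp [signedPow]

theorem signedPow_of_nonneg {s a : ℝ} (hs : 0 ≤ s) (ha : 0 ≤ a) :
    signedPow s a = a ^ (1 + s) := by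
  rw [signedPow, abs_of_nonneg ha, Real.rpow_one_add' ha (by linarith)]

/-- A property of pairs of reals that is invariant under swaps and under sign changes holds for all
pairs if it holds for nonnegative ones and for those of opposite signs. -/
theorem real_pair_induction {P : ℝ → ℝ → Prop} (hswap : ∀ a b, P a b → P b a)
    (hneg : ∀ a b, P a b → P (-a) (-b)) (hsame : ∀ a b, 0 ≤ b → b ≤ a → P a b)
    (hopp : ∀ a b, 0 ≤ a → 0 ≤ b → P a (-b)) (a b : ℝ) : P a b := by
  have hpos : ∀ a b, 0 ≤ a → 0 ≤ b → P a b := fun a b ha hb =>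
    (le_total b a).elim (hsame a b hb) fun h => hswap _ _ (hsame b a ha h)
  rcases le_total 0 a with ha | ha <;> rcases le_total 0 b with hb | hb
  · exact hpos a b ha hb
  · simpa using hopp a (-b) ha (by linarith)
  · simpa using hneg _ _ (hopp (-a) b (by linarith) hb)
  · simpa using hneg _ _ (hpos (-a) (-b) (by linarith) (by linarith))

/-- For equal signs this is superadditivity of `t ^ (1 + s)`; for opposite signs it is convexity,
with constant `2 ^ s ≤ 2`. -/
theorem abs_sub_rpow_le_signedPow {s : ℝ} (hs : 0 ≤ s) (hs1 : s ≤ 1) (a b : ℝ) :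
    |a - b| ^ (1 + s) ≤ 2 * |signedPow s a - signedPow s b| := by
  refine real_pair_induction (P := fun a b => |a - b| ^ (1 + s) ≤
    2 * |signedPow s a - signedPow s b|) (fun a b h => ?_) (fun a b h => ?_)
    (fun a b hb hab => ?_) (fun a b ha hb => ?_) a b
  · rwa [abs_sub_comm b, abs_sub_comm (signedPow s b)]
  · rwa [signedPow_neg, signedPow_neg, neg_sub_neg, neg_sub_neg, abs_sub_comm b,
      abs_sub_comm (signedPow s b)]
  · rw [signedPow_of_nonneg hs (hb.trans hab), signedPow_of_nonneg hs hb,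
      abs_of_nonneg (sub_nonneg.2 hab)]
    have h := Real.add_rpow_le_rpow_add (sub_nonneg.2 hab) hb (by linarith : 1 ≤ 1 + s)
    rw [sub_add_cancel] at h
    have h0 : 0 ≤ (a - b) ^ (1 + s) := Real.rpow_nonneg (sub_nonneg.2 hab) _
    rw [abs_of_nonneg (by linarith)]
    linarith
  · have ha' := Real.rpow_nonneg ha (1 + s)
    have hb' := Real.rpow_nonneg hb (1 + s)
    rw [signedPow_neg, signedPow_of_nonneg hs ha, signedPow_of_nonneg hs hb, sub_neg_eq_add,
      sub_neg_eq_add, abs_of_nonneg (by positivity), abs_of_nonneg (by positivity)]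
    have h := NNReal.rpow_add_le_mul_rpow_add_rpow ⟨a, ha⟩ ⟨b, hb⟩ (by linarith : 1 ≤ 1 + s)
    have h' : (a + b) ^ (1 + s) ≤ 2 ^ (1 + s - 1) * (a ^ (1 + s) + b ^ (1 + s)) := by
      exact_mod_cast h
    refine h'.trans (mul_le_mul_of_nonneg_right ?_ (by positivity))
    calc (2 : ℝ) ^ (1 + s - 1) ≤ 2 ^ (1 : ℝ) :=
          Real.rpow_le_rpow_of_exponent_le one_le_two (by linarith)
      _ = 2 := Real.rpow_one 2

/-- A mean value bound: the derivative has size `(1 + s) |c| ^ s` with `1 + s ≤ 2`. -/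
theorem abs_signedPow_sub_le {s : ℝ} (hs : 0 ≤ s) (hs1 : s ≤ 1) (a b : ℝ) :
    |signedPow s a - signedPow s b| ≤ 2 * ((|a| + |b|) ^ s * |a - b|) := by
  refine real_pair_induction (P := fun a b => |signedPow s a - signedPow s b| ≤
    2 * ((|a| + |b|) ^ s * |a - b|)) (fun a b h => ?_) (fun a b h => ?_)
    (fun a b hb hab => ?_) (fun a b ha hb => ?_) a b
  · rwa [abs_sub_comm (signedPow s b), abs_sub_comm b, add_comm |b|]
  · rwa [signedPow_neg, signedPow_neg, neg_sub_neg, neg_sub_neg, abs_sub_comm b,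
      abs_sub_comm (signedPow s b), abs_neg, abs_neg]
  · have ha := hb.trans hab
    rcases ha.eq_or_lt with h0 | h0
    · obtain rfl : b = 0 := by linarith
      rw [← h0]
      simp
    have has := Real.rpow_nonneg ha s
    have hbs := Real.rpow_nonneg hb s
    have hmono : b ^ s ≤ a ^ s := Real.rpow_le_rpow hb hab hs
    have hmono' : a ^ s ≤ (a + b) ^ s := Real.rpow_le_rpow ha (by linarith) hs
    -- For positive `b` this is `b ^ (1 - s) ≤ a ^ (1 - s)`, multiplied by `a ^ s * b ^ s`.
    have hkey : b * a ^ s ≤ a * b ^ s := by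
      rcases hb.eq_or_lt with rfl | hb0
      · rw [zero_mul]
        exact mul_nonneg ha hbs
      have h1 := Real.rpow_le_rpow hb hab (by linarith : 0 ≤ 1 - s)
      have ha1 : a = a ^ s * a ^ (1 - s) := by rw [← Real.rpow_add h0]; simp
      have hb1 : b = b ^ s * b ^ (1 - s) := by rw [← Real.rpow_add hb0]; simp
      calc b * a ^ s = a ^ s * b ^ s * b ^ (1 - s) := by conv_lhs => rw [hb1]
                                                         ring
        _ ≤ a ^ s * b ^ s * a ^ (1 - s) := by gcongr
        _ = a * b ^ s := by conv_rhs => rw [ha1]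
                            ring
    have hnn : b * b ^ s ≤ a * a ^ s := mul_le_mul hab hmono hbs ha
    rw [signedPow, signedPow, abs_of_nonneg ha, abs_of_nonneg hb,
      abs_of_nonneg (sub_nonneg.2 hab), abs_of_nonneg (sub_nonneg.2 hnn)]
    have h2 : a * a ^ s - b * b ^ s ≤ 2 * (a ^ s * (a - b)) := by
      refine le_of_mul_le_mul_left ?_ h0
      nlinarith [mul_le_mul_of_nonneg_left hkey hb, mul_nonneg has (sq_nonneg (a - b))]
    refine h2.trans ?_
    have : 0 ≤ a - b := sub_nonneg.2 hab
    gcongr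
  · have hsum : 0 ≤ a + b := add_nonneg ha hb
    have hA : a ^ s ≤ (a + b) ^ s := Real.rpow_le_rpow ha (by linarith) hs
    have hB : b ^ s ≤ (a + b) ^ s := Real.rpow_le_rpow hb (by linarith) hs
    have has := Real.rpow_nonneg ha s
    have hbs := Real.rpow_nonneg hb s
    rw [signedPow_neg, sub_neg_eq_add, sub_neg_eq_add, abs_neg, signedPow, signedPow,
      abs_of_nonneg ha, abs_of_nonneg hb, abs_of_nonneg hsum,
      abs_of_nonneg (add_nonneg (mul_nonneg ha has) (mul_nonneg hb hbs))]
    nlinarith [mul_le_mul_of_nonneg_left hA ha, mul_le_mul_of_nonneg_left hB hb,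
      mul_nonneg (has.trans hA) hsum]

/-- The Mazur map from the unit sphere of `ℓ_2` to that of `ℓ_p` is Lipschitz. -/
theorem summable_mazur_and_tsum_le {W : Type*} {p : ℝ} (h1 : 1 ≤ p) (h2 : p ≤ 2) {u v : W → ℝ}
    {D : ℝ} (hu : HasSum (fun w => u w ^ 2) 1) (hv : HasSum (fun w => v w ^ 2) 1)
    (hD : HasSum (fun w => (u w - v w) ^ 2) D) :
    Summable (fun w => |signedPow (2 / p - 1) (u w) - signedPow (2 / p - 1) (v w)| ^ p) ∧
      ∑' w, |signedPow (2 / p - 1) (u w) - signedPow (2 / p - 1) (v w)| ^ p ≤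
        16 * D ^ (p / 2) := by
  have hp0 : 0 < p := by linarith
  have hs : 0 ≤ 2 / p - 1 := by rw [sub_nonneg, le_div_iff₀ hp0]; linarith
  have hs1 : 2 / p - 1 ≤ 1 := by
    have : 2 / p ≤ 2 := div_le_self (by norm_num) h1
    linarith
  have hD0 : 0 ≤ D := hD.nonneg fun w => sq_nonneg _
  rcases hD0.eq_or_lt with rfl | hD0
  · have heq : ∀ w, u w = v w := fun w => by
      have := (hasSum_zero_iff_of_nonneg fun w => sq_nonneg (u w - v w)).1 hD
      have h := congrFun this w
      simp only [Pi.zero_apply] at h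
      exact sub_eq_zero.1 (pow_eq_zero_iff two_ne_zero |>.1 h)
    simp [heq, Real.zero_rpow hp0.ne', Real.zero_rpow (by positivity : p / 2 ≠ 0), summable_zero]
  -- A pointwise form of Hölder: weighted AM-GM with exponents `1 - p / 2` and `p / 2`, after
  -- dividing `(u - v)²` by its sum `D`. Summed, the bracket is `4 (1 - p / 2) + p / 2 ≤ 4`, whence
  -- the constant `16`.
  have hbound : ∀ w, |signedPow (2 / p - 1) (u w) - signedPow (2 / p - 1) (v w)| ^ p ≤
      4 * D ^ (p / 2) * ((1 - p / 2) * (2 * u w ^ 2 + 2 * v w ^ 2) +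
        p / 2 * ((u w - v w) ^ 2 / D)) := fun w => by
    set A := |u w| + |v w| with hA
    have hA0 : 0 ≤ A := by positivity
    have hA2 : A ^ 2 ≤ 2 * u w ^ 2 + 2 * v w ^ 2 := by
      rw [hA, ← sq_abs (u w), ← sq_abs (v w)]
      nlinarith [sq_nonneg (|u w| - |v w|)]
    have hAM := Real.geom_mean_le_arith_mean2_weighted (w₁ := 1 - p / 2) (w₂ := p / 2)
      (p₁ := A ^ 2) (p₂ := (u w - v w) ^ 2 / D) (by linarith) (by linarith) (by positivity)
      (by positivity) (by ring)
    have hDpow : (D ^ (p / 2)) ≠ 0 := (Real.rpow_pos_of_pos hD0 _).ne'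
    have hsq : ∀ {x r : ℝ}, 0 ≤ x → (x ^ 2) ^ r = x ^ (2 * r) := fun hx => by
      rw [← Real.rpow_two, ← Real.rpow_mul hx]
    have heq : A ^ ((2 / p - 1) * p) * |u w - v w| ^ p =
        D ^ (p / 2) * ((A ^ 2) ^ (1 - p / 2) * ((u w - v w) ^ 2 / D) ^ (p / 2)) := by
      rw [Real.div_rpow (sq_nonneg _) hD0.le, hsq hA0, ← sq_abs (u w - v w), hsq (abs_nonneg _)]
      have e1 : (2 / p - 1) * p = 2 * (1 - p / 2) := by field_simp
      have e2 : 2 * (p / 2) = p := by ring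
      rw [e1, e2]
      field_simp
    calc _ ≤ (2 * (A ^ (2 / p - 1) * |u w - v w|)) ^ p :=
          Real.rpow_le_rpow (abs_nonneg _) (abs_signedPow_sub_le hs hs1 _ _) hp0.le
      _ = 2 ^ p * (A ^ ((2 / p - 1) * p) * |u w - v w| ^ p) := by
          rw [Real.mul_rpow (by norm_num) (by positivity),
            Real.mul_rpow (by positivity) (abs_nonneg _), ← Real.rpow_mul hA0]
      _ ≤ 4 * (A ^ ((2 / p - 1) * p) * |u w - v w| ^ p) := by
          refine mul_le_mul_of_nonneg_right ?_ (by positivity)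
          calc (2 : ℝ) ^ p ≤ 2 ^ (2 : ℝ) := Real.rpow_le_rpow_of_exponent_le one_le_two h2
            _ = 4 := by rw [Real.rpow_two]; norm_num
      _ = 4 * D ^ (p / 2) * ((A ^ 2) ^ (1 - p / 2) * ((u w - v w) ^ 2 / D) ^ (p / 2)) := by
          rw [heq, mul_assoc]
      _ ≤ _ := by
          refine mul_le_mul_of_nonneg_left (hAM.trans ?_) (by positivity)
          gcongr
          linarith
  have hsum := ((((hu.mul_left 2).add (hv.mul_left 2)).mul_left (1 - p / 2)).add
    ((hD.div_const D).mul_left (p / 2))).mul_left (4 * D ^ (p / 2))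
  have hsummable := Summable.of_nonneg_of_le (fun w => by positivity) hbound hsum.summable
  refine ⟨hsummable, (hasSum_le hbound hsummable.hasSum hsum).trans ?_⟩
  rw [div_self hD0.ne']
  have := Real.rpow_pos_of_pos hD0 (p / 2)
  nlinarith

/-- The `p`-th power of `abs_sub_rpow_le_signedPow`: for `s = 2 / p - 1` one has `(1 + s) p = 2`,
and `2 ^ p ≤ 4`. -/
theorem le_tsum_mazur {W : Type*} {p : ℝ} (h1 : 1 ≤ p) (h2 : p ≤ 2) {u v : W → ℝ}
    {D : ℝ} (hD : HasSum (fun w => (u w - v w) ^ 2) D)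
    (hsum : Summable fun w => |signedPow (2 / p - 1) (u w) - signedPow (2 / p - 1) (v w)| ^ p) :
    D ≤ 4 * ∑' w, |signedPow (2 / p - 1) (u w) - signedPow (2 / p - 1) (v w)| ^ p := by
  have hp0 : 0 < p := by linarith
  have hs : 0 ≤ 2 / p - 1 := by rw [sub_nonneg, le_div_iff₀ hp0]; linarith
  have hs1 : 2 / p - 1 ≤ 1 := by
    have : 2 / p ≤ 2 := div_le_self (by norm_num) h1
    linarith
  refine hasSum_le (fun w => ?_) hD (hsum.hasSum.mul_left 4)
  have h := Real.rpow_le_rpow (by positivity) (abs_sub_rpow_le_signedPow hs hs1 (u w) (v w)) hp0.le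
  rw [← Real.rpow_mul (abs_nonneg _), add_sub_cancel, div_mul_cancel₀ _ hp0.ne', Real.rpow_two,
    sq_abs, Real.mul_rpow (by norm_num) (abs_nonneg _)] at h
  refine h.trans (mul_le_mul_of_nonneg_right ?_ (by positivity))
  calc (2 : ℝ) ^ p ≤ 2 ^ (2 : ℝ) := Real.rpow_le_rpow_of_exponent_le one_le_two h2
    _ = 4 := by rw [Real.rpow_two]; norm_num

/-! ### Gaussian kernels on `ℓ_2` -/

theorem HasSum.congr_real {ι : Type*} {f g : ι → ℝ} {a b : ℝ} (h : HasSum f a)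
    (hfg : ∀ i, g i = f i) (hab : b = a) : HasSum g b := by
  rwa [hab, funext hfg]

theorem hasSum_prod_pi {f : ℕ → ℝ} {b : ℝ} (hf : HasSum f b) (n : ℕ) :
    HasSum (fun w : Fin n → ℕ => ∏ i, f (w i)) (b ^ n) := by
  induction n with
  | zero => simp [hasSum_unique]
  | succ n ih =>
    set g : (Fin n → ℕ) → ℝ := fun w => ∏ i, f (w i) with hg
    have hs : Summable fun w : ℕ × (Fin n → ℕ) => f w.1 * g w.2 :=
      summable_mul_of_summable_norm hf.summable.norm ih.summable.norm
    have h : HasSum (fun w : ℕ × (Fin n → ℕ) => f w.1 * g w.2) (b * b ^ n) := hf.mul ih hs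
    rw [← (Fin.consEquiv fun _ : Fin (n + 1) => ℕ).hasSum_iff]
    refine h.congr_real (fun w => ?_) (pow_succ' b n)
    simp [hg, Fin.consEquiv, Fin.prod_univ_succ]

/-- The words of finite length in the natural numbers. -/
abbrev Word : Type := Σ n : ℕ, Fin n → ℕ

/-- The exponential series with each power `b ^ n` expanded over words of length `n`; the same
identity for `|f|` gives absolute convergence. -/
theorem hasSum_exp_words {f : ℕ → ℝ} {b : ℝ} (hf : HasSum f b) {c : ℝ} (hc : 0 ≤ c) :
    HasSum (fun w : Word => c ^ w.1 / w.1.factorial * ∏ i, f (w.2 i)) (Real.exp (c * b)) := by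
  have hfib : ∀ {g : ℕ → ℝ} {a : ℝ}, HasSum g a → ∀ n, HasSum
      (fun w : Fin n → ℕ => c ^ n / n.factorial * ∏ i, g (w i)) ((c * a) ^ n / n.factorial) :=
    fun hg n => by
      have := (hasSum_prod_pi hg n).mul_left (c ^ n / n.factorial)
      rwa [div_mul_eq_mul_div, ← mul_pow] at this
  have hexp : ∀ a : ℝ, HasSum (fun n => (c * a) ^ n / (n.factorial : ℝ)) (Real.exp (c * a)) := by
    intro a
    rw [Real.exp_eq_exp_ℝ]
    exact NormedSpace.expSeries_div_hasSum_exp (c * a)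
  refine HasSum.sigma_of_hasSum (hexp b) (fun n => hfib hf n) ?_
  have habs : HasSum (fun i => |f i|) (∑' i, |f i|) := hf.summable.abs.hasSum
  refine Summable.of_norm_bounded (g := fun w : Word => c ^ w.1 / w.1.factorial *
    ∏ i, |f (w.2 i)|) ?_ fun w => ?_
  · rw [summable_sigma_of_nonneg fun w => by positivity]
    refine ⟨fun n => (hfib habs n).summable, ?_⟩
    simp_rw [(hfib habs _).tsum_eq]
    exact (hexp _).summable
  · rw [norm_mul, Real.norm_of_nonneg (by positivity), Real.norm_eq_abs, Finset.abs_prod]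

namespace OrliczFunction

/-- The modular at `ρ` is `∑ x_i² / ρ²`, so the Luxemburg norm is the `ℓ_2` norm. -/
theorem hasSum_sq_norm_quad (x : quad.h) : HasSum (fun i => x.1.seq i ^ 2) (‖x‖ ^ 2) := by
  have hmod : ∀ ρ : ℝ, 0 < ρ → quad.modular x.1.seq ρ =
      ∑' i, ENNReal.ofReal (x.1.seq i ^ 2 / ρ ^ 2) := fun ρ hρ => by
    simp only [modular, quad_apply, div_pow, sq_abs]
  have hsum : Summable fun i => x.1.seq i ^ 2 := by
    have h := x.2 1 one_pos
    rw [hmod 1 one_pos] at h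
    have := ENNReal.summable_toReal h.ne
    simpa [ENNReal.toReal_ofReal, sq_nonneg] using this
  have hmod' : ∀ ρ : ℝ, 0 < ρ → quad.modular x.1.seq ρ =
      ENNReal.ofReal ((∑' i, x.1.seq i ^ 2) / ρ ^ 2) := fun ρ hρ => by
    rw [hmod ρ hρ, ← ENNReal.ofReal_tsum_of_nonneg (fun i => by positivity) (hsum.div_const _),
      tsum_div_const]
  have hS0 : 0 ≤ ∑' i, x.1.seq i ^ 2 := tsum_nonneg fun i => sq_nonneg _
  have h0 : 0 ≤ ‖x.1‖ := norm_nonneg _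
  have heq : ‖x.1‖ = √(∑' i, x.1.seq i ^ 2) := by
    refine le_antisymm ?_ ?_ <;>
      refine le_of_forall_pos_le_add fun ε hε => ?_
    · have hρ : 0 < √(∑' i, x.1.seq i ^ 2) + ε := by positivity
      refine quad.norm_le_of hρ ?_
      rw [hmod' _ hρ, ENNReal.ofReal_le_one, div_le_one (by positivity)]
      exact (Real.sqrt_le_left hρ.le).1 (by linarith)
    · obtain ⟨hρ, h⟩ := quad.modular_le_one (lt_add_of_pos_right ‖x.1‖ hε)
      rw [hmod' _ hρ, ENNReal.ofReal_le_one, div_le_one (by positivity)] at h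
      exact Real.sqrt_le_iff.2 ⟨hρ.le, h⟩
  change HasSum _ (‖x.1‖ ^ 2)
  rw [heq, Real.sq_sqrt hS0]
  exact hsum.hasSum

theorem hasSum_mul_quad (x y : quad.h) : HasSum (fun i => x.1.seq i * y.1.seq i)
    ((‖x‖ ^ 2 + ‖y‖ ^ 2 - dist x y ^ 2) / 2) := by
  have h := ((hasSum_sq_norm_quad x).add (hasSum_sq_norm_quad y)).sub (hasSum_sq_norm_quad (x - y))
  rw [dist_eq_norm]
  refine (h.div_const 2).congr_real (fun i => ?_) rfl
  change _ = (x.1.seq i ^ 2 + y.1.seq i ^ 2 - (x.1.seq i - y.1.seq i) ^ 2) / 2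
  ring

/-- The coordinates of the Gaussian feature map, whose kernel is `exp (-t d(x, y)²)`. -/
def gaussFeature (t : ℝ) (x : quad.h) (w : Word) : ℝ :=
  Real.exp (-t * ‖x‖ ^ 2) * (√((2 * t) ^ w.1 / w.1.factorial) * ∏ i, x.1.seq (w.2 i))

/-- Split `exp (-t d²)` into `exp (-t ‖x‖²) exp (-t ‖y‖²) exp (2t ⟨x, y⟩)` and expand the last
factor over words. -/
theorem hasSum_gaussFeature_mul {t : ℝ} (ht : 0 ≤ t) (x y : quad.h) :
    HasSum (fun w => gaussFeature t x w * gaussFeature t y w) (Real.exp (-t * dist x y ^ 2)) := by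
  have h := (hasSum_exp_words (hasSum_mul_quad x y) (by positivity : 0 ≤ 2 * t)).mul_left
    (Real.exp (-t * ‖x‖ ^ 2) * Real.exp (-t * ‖y‖ ^ 2))
  rw [← Real.exp_add, ← Real.exp_add] at h
  refine h.congr_real (fun w => ?_) ?_
  · have hsq : √((2 * t) ^ w.1 / w.1.factorial) * √((2 * t) ^ w.1 / w.1.factorial) =
        (2 * t) ^ w.1 / w.1.factorial := Real.mul_self_sqrt (by positivity)
    rw [Finset.prod_mul_distrib, Real.exp_add, ← hsq]
    unfold gaussFeature
    ring
  · congr 1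
    ring

theorem hasSum_gaussFeature_sq {t : ℝ} (ht : 0 ≤ t) (x : quad.h) :
    HasSum (fun w => gaussFeature t x w ^ 2) 1 := by
  have h := hasSum_gaussFeature_mul ht x x
  rw [dist_self, zero_pow two_ne_zero, mul_zero, Real.exp_zero] at h
  simpa only [← pow_two] using h

theorem hasSum_gaussFeature_sub_sq {t : ℝ} (ht : 0 ≤ t) (x y : quad.h) :
    HasSum (fun w => (gaussFeature t x w - gaussFeature t y w) ^ 2)
      (2 * (1 - Real.exp (-t * dist x y ^ 2))) := by
  have h := ((hasSum_gaussFeature_sq ht x).add (hasSum_gaussFeature_sq ht y)).sub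
    ((hasSum_gaussFeature_mul ht x y).mul_left 2)
  exact h.congr_real (fun w => by ring) (by ring)

end OrliczFunction
end

/-! ### Combining the scales: the embedding of `ℓ_2` into `ℓ_p` -/

noncomputable section
namespace OrliczFunction

/-- The images of the Gaussian features at all dyadic scales under the Mazur map. -/
def mazurFeature (p : ℝ) (x : quad.h) (k : ℕ × Word) : ℝ :=
  signedPow (2 / p - 1) (gaussFeature ((1 / 4) ^ k.1) x k.2)

/-- The lower modulus `∑ (1 - exp (-d² / 4ⁿ)) / 2`. -/
def gaussModulus (d : ℝ) : ℝ := ∑' n : ℕ, (1 - Real.exp (-(1 / 4) ^ n * d ^ 2)) / 2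

theorem one_sub_exp_le (a : ℝ) : 1 - Real.exp (-a) ≤ a := by
  linarith [Real.add_one_le_exp (-a)]

theorem gaussModulus_term_nonneg (n : ℕ) (d : ℝ) :
    0 ≤ (1 - Real.exp (-(1 / 4) ^ n * d ^ 2)) / 2 := by
  have : Real.exp (-(1 / 4) ^ n * d ^ 2) ≤ 1 := by
    rw [Real.exp_le_one_iff, neg_mul]
    exact neg_nonpos.2 (by positivity)
  linarith

theorem gaussModulus_nonneg (d : ℝ) : 0 ≤ gaussModulus d :=
  tsum_nonneg fun n => gaussModulus_term_nonneg n d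

theorem summable_gaussModulus (d : ℝ) :
    Summable fun n : ℕ => (1 - Real.exp (-(1 / 4) ^ n * d ^ 2)) / 2 := by
  refine Summable.of_nonneg_of_le (fun n => gaussModulus_term_nonneg n d) (fun n => ?_)
    ((summable_geometric_of_lt_one (by norm_num) (by norm_num : (1 / 4 : ℝ) < 1)).mul_right (d ^ 2))
  have h := one_sub_exp_le ((1 / 4) ^ n * d ^ 2)
  rw [← neg_mul] at h
  have : 0 ≤ (1 / 4 : ℝ) ^ n * d ^ 2 := by positivity
  linarith

theorem gaussModulus_mono {c d : ℝ} (hc : 0 ≤ c) (hcd : c ≤ d) :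
    gaussModulus c ≤ gaussModulus d := by
  refine Summable.tsum_le_tsum (fun n => ?_) (summable_gaussModulus c) (summable_gaussModulus d)
  have : Real.exp (-(1 / 4) ^ n * d ^ 2) ≤ Real.exp (-(1 / 4) ^ n * c ^ 2) := by
    rw [Real.exp_le_exp, neg_mul, neg_mul, neg_le_neg_iff]
    gcongr
  linarith

theorem gaussModulus_pos {d : ℝ} (hd : 0 < d) : 0 < gaussModulus d := by
  refine (summable_gaussModulus d).tsum_pos (fun n => gaussModulus_term_nonneg n d) 0 ?_
  have : Real.exp (-(1 / 4) ^ 0 * d ^ 2) < 1 := by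
    rw [Real.exp_lt_one_iff, pow_zero]
    nlinarith
  linarith

/-- Once `d ≥ 2 ^ N`, each of the first `N` scales contributes at least `1 / 4`. -/
theorem tendsto_gaussModulus : Tendsto gaussModulus atTop atTop := by
  refine tendsto_atTop.2 fun K => ?_
  obtain ⟨N, hN⟩ := exists_nat_ge (4 * K)
  filter_upwards [eventually_ge_atTop ((2 : ℝ) ^ N)] with d hd
  have hterm : ∀ n ∈ Finset.range N, 1 / 4 ≤ (1 - Real.exp (-(1 / 4) ^ n * d ^ 2)) / 2 := by
    intro n hn
    have h1 : 1 ≤ (1 / 4 : ℝ) ^ n * d ^ 2 := by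
      have h2 : (2 : ℝ) ^ n ≤ d := (pow_le_pow_right₀ one_le_two (Finset.mem_range.1 hn).le).trans hd
      calc (1 : ℝ) = (1 / 4 : ℝ) ^ n * (2 ^ n) ^ 2 := by
            rw [← pow_mul, mul_comm n 2, pow_mul, ← mul_pow]; norm_num
        _ ≤ _ := by gcongr
    have h3 : Real.exp (-(1 / 4) ^ n * d ^ 2) ≤ 1 / 2 := by
      calc Real.exp (-(1 / 4) ^ n * d ^ 2) ≤ Real.exp (-1) := by
            rw [Real.exp_le_exp, neg_mul]; linarith
        _ ≤ 1 / 2 := by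
            rw [Real.exp_neg, one_div]
            refine inv_anti₀ two_pos ?_
            linarith [Real.add_one_le_exp 1]
    linarith
  calc K ≤ N * (1 / 4) := by linarith
    _ = ∑ n ∈ Finset.range N, (1 / 4 : ℝ) := by simp
    _ ≤ ∑ n ∈ Finset.range N, (1 - Real.exp (-(1 / 4) ^ n * d ^ 2)) / 2 := Finset.sum_le_sum hterm
    _ ≤ gaussModulus d := (summable_gaussModulus d).sum_le_tsum _ fun n _ =>
        gaussModulus_term_nonneg n d

/-- At scale `4⁻ⁿ` the squared feature distance is `D = 2 (1 - exp (-4⁻ⁿ d²)) ≤ 2 (d / 2ⁿ)²`. The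
Mazur bounds `D / 4` from below and `16 D ^ (p / 2)` from above give the claim; the factor `2 ^
(-n)` makes the scales summable. -/
theorem mazurFeature_scale {p : ℝ} (h1 : 1 ≤ p) (h2 : p ≤ 2) (x y : quad.h) (n : ℕ) :
    Summable (fun w => |mazurFeature p x (n, w) - mazurFeature p y (n, w)| ^ p) ∧
      ∑' w, |mazurFeature p x (n, w) - mazurFeature p y (n, w)| ^ p ≤
        32 * dist x y ^ p * (1 / 2) ^ n ∧
      (1 - Real.exp (-(1 / 4) ^ n * dist x y ^ 2)) / 2 ≤
        ∑' w, |mazurFeature p x (n, w) - mazurFeature p y (n, w)| ^ p := by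
  have ht : (0 : ℝ) ≤ (1 / 4) ^ n := by positivity
  have hD := hasSum_gaussFeature_sub_sq ht x y
  obtain ⟨hs, hle⟩ := summable_mazur_and_tsum_le h1 h2 (hasSum_gaussFeature_sq ht x)
    (hasSum_gaussFeature_sq ht y) hD
  refine ⟨hs, hle.trans ?_, ?_⟩
  · set d := dist x y with hd
    have hd0 : 0 ≤ d := dist_nonneg
    have hb0 : (0 : ℝ) ≤ (1 / 2) ^ n := by positivity
    have h3 := one_sub_exp_le ((1 / 4) ^ n * d ^ 2)
    rw [← neg_mul] at h3
    have h4 : (1 / 4 : ℝ) ^ n * d ^ 2 = ((1 / 2) ^ n * d) ^ 2 := by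
      rw [mul_pow, ← pow_mul, mul_comm n 2, pow_mul]
      norm_num
    have h0 : 0 ≤ 2 * (1 - Real.exp (-(1 / 4) ^ n * d ^ 2)) := by
      have := gaussModulus_term_nonneg n d
      linarith
    calc 16 * (2 * (1 - Real.exp (-(1 / 4) ^ n * d ^ 2))) ^ (p / 2)
        ≤ 16 * (2 * ((1 / 2) ^ n * d) ^ 2) ^ (p / 2) := by
          refine mul_le_mul_of_nonneg_left (Real.rpow_le_rpow h0 ?_ (by linarith)) (by norm_num)
          linarith
      _ = 16 * (2 ^ (p / 2) * (((1 / 2) ^ n) ^ p * d ^ p)) := by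
          rw [Real.mul_rpow (by norm_num) (by positivity), ← Real.rpow_two,
            ← Real.rpow_mul (by positivity), mul_div_cancel₀ _ (two_ne_zero' ℝ),
            Real.mul_rpow hb0 hd0]
      _ ≤ 16 * (2 * ((1 / 2) ^ n * d ^ p)) := by
          have h5 : (2 : ℝ) ^ (p / 2) ≤ 2 := by
            calc (2 : ℝ) ^ (p / 2) ≤ 2 ^ (1 : ℝ) :=
                  Real.rpow_le_rpow_of_exponent_le one_le_two (by linarith)
              _ = 2 := Real.rpow_one 2
          have h6 : (((1 / 2 : ℝ)) ^ n) ^ p ≤ (1 / 2) ^ n :=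
            Real.rpow_le_self_of_le_one hb0 (pow_le_one₀ (by norm_num) (by norm_num)) h1
          gcongr
      _ = _ := by ring
  · have := le_tsum_mazur h1 h2 hD hs
    unfold mazurFeature
    linarith

theorem summable_mazurFeature {p : ℝ} (h1 : 1 ≤ p) (h2 : p ≤ 2) (x y : quad.h) :
    Summable (fun k => |mazurFeature p x k - mazurFeature p y k| ^ p) := by
  rw [summable_prod_of_nonneg fun k => by positivity]
  refine ⟨fun n => (mazurFeature_scale h1 h2 x y n).1, ?_⟩
  exact Summable.of_nonneg_of_le (fun n => tsum_nonneg fun w => by positivity)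
    (fun n => (mazurFeature_scale h1 h2 x y n).2.1)
    ((summable_geometric_of_lt_one (by norm_num) (by norm_num)).mul_left _)

theorem tsum_mazurFeature_le {p : ℝ} (h1 : 1 ≤ p) (h2 : p ≤ 2) (x y : quad.h) :
    ∑' k, |mazurFeature p x k - mazurFeature p y k| ^ p ≤ 64 * dist x y ^ p := by
  have hs := summable_mazurFeature h1 h2 x y
  rw [hs.tsum_prod]
  have hg := (hasSum_geometric_of_lt_one (r := (1 / 2 : ℝ)) (by norm_num)
    (by norm_num)).mul_left (32 * dist x y ^ p)
  refine (hasSum_le (fun n => (mazurFeature_scale h1 h2 x y n).2.1) hs.prod.hasSum hg).trans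
    (le_of_eq ?_)
  norm_num
  ring

theorem gaussModulus_le_tsum_mazurFeature {p : ℝ} (h1 : 1 ≤ p) (h2 : p ≤ 2) (x y : quad.h) :
    gaussModulus (dist x y) ≤ ∑' k, |mazurFeature p x k - mazurFeature p y k| ^ p := by
  have hs := summable_mazurFeature h1 h2 x y
  rw [hs.tsum_prod]
  exact Summable.tsum_le_tsum (fun n => (mazurFeature_scale h1 h2 x y n).2.2)
    (summable_gaussModulus _) hs.prod

theorem exists_quad_embedding (p : ℝ≥0∞) [Fact (1 ≤ p)] (hp : p ≤ 2) :
    ∃ f : quad.h → RealEllP p, ∀ x y, dist (f x) (f y) ≤ 64 * dist x y ∧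
      gaussModulus (dist x y) ^ p.toReal⁻¹ ≤ dist (f x) (f y) := by
  have hptop : p ≠ ∞ := ne_top_of_le_ne_top (by norm_num) hp
  have h1 : 1 ≤ p.toReal := by simpa using ENNReal.toReal_mono hptop (Fact.out : 1 ≤ p)
  have h2 : p.toReal ≤ 2 := by simpa using ENNReal.toReal_mono (by norm_num) hp
  have h0 : 0 < p.toReal := by linarith
  obtain ⟨hden⟩ := nonempty_denumerable (ℕ × Word)
  let e : ℕ ≃ ℕ × Word := (Denumerable.eqv (ℕ × Word)).symm
  -- Each scale alone has `ℓ_p` norm `1`, so the full family is not in `ℓ_p`; only differences are,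
  -- hence the base point `0`.
  have hmem : ∀ x : quad.h, Memℓp
      (fun i => mazurFeature p.toReal x (e i) - mazurFeature p.toReal 0 (e i)) p := fun x => by
    refine (memℓp_gen_iff h0).2 ?_
    simp_rw [Real.norm_eq_abs]
    exact e.summable_iff.2 (summable_mazurFeature h1 h2 x 0)
  let f : quad.h → RealEllP p := fun x => ⟨_, hmem x⟩
  have hdist : ∀ x y, dist (f x) (f y) ^ p.toReal =
      ∑' k, |mazurFeature p.toReal x k - mazurFeature p.toReal y k| ^ p.toReal := fun x y => by
    rw [dist_eq_norm, lp.norm_rpow_eq_tsum h0, ← e.tsum_eq]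
    refine tsum_congr fun i => ?_
    change |mazurFeature p.toReal x (e i) - mazurFeature p.toReal 0 (e i) -
      (mazurFeature p.toReal y (e i) - mazurFeature p.toReal 0 (e i))| ^ p.toReal = _
    rw [sub_sub_sub_cancel_right]
  refine ⟨f, fun x y => ⟨?_, ?_⟩⟩
  · rw [← Real.rpow_le_rpow_iff dist_nonneg (by positivity) h0, hdist,
      Real.mul_rpow (by norm_num) dist_nonneg]
    refine (tsum_mazurFeature_le h1 h2 x y).trans
      (mul_le_mul_of_nonneg_right ?_ (Real.rpow_nonneg dist_nonneg _))
    exact Real.self_le_rpow_of_one_le (by norm_num) h1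
  · rw [Real.rpow_inv_le_iff_of_pos (gaussModulus_nonneg _)
      dist_nonneg h0, hdist]
    exact gaussModulus_le_tsum_mazurFeature h1 h2 x y

theorem stronglyUniformlyEmbeds_quad (p : ℝ≥0∞) [Fact (1 ≤ p)] (hp : p ≤ 2) :
    StronglyUniformlyEmbeds quad.h (RealEllP p) := by
  obtain ⟨f, hf⟩ := exists_quad_embedding p hp
  have hptop : p ≠ ∞ := ne_top_of_le_ne_top (by norm_num) hp
  have h0 : 0 < p.toReal⁻¹ :=
    inv_pos.2 (ENNReal.toReal_pos (zero_lt_one.trans_le Fact.out).ne' hptop)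
  have hmono : ∀ {c d : ℝ}, 0 ≤ c → c ≤ d →
      gaussModulus c ^ p.toReal⁻¹ ≤ gaussModulus d ^ p.toReal⁻¹ := fun hc hcd =>
    Real.rpow_le_rpow (gaussModulus_nonneg _) (gaussModulus_mono hc hcd) h0.le
  refine ⟨f, ⟨fun d => (gaussModulus d ^ p.toReal⁻¹).toNNReal, fun d => 64 * d, ?_, ?_, ?_, ?_⟩, ?_⟩
  · exact fun c d hcd => Real.toNNReal_le_toNNReal (hmono c.2 hcd)
  · exact fun c d hcd => mul_le_mul_right hcd 64
  · exact tendsto_real_toNNReal_atTop.comp ((tendsto_rpow_atTop h0).comp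
      (tendsto_gaussModulus.comp (NNReal.tendsto_coe_atTop.2 tendsto_id)))
  · refine fun x y => ⟨Real.toNNReal_le_iff_le_coe.2 (hf x y).2, ?_⟩
    rw [← NNReal.coe_le_coe]
    exact (hf x y).1
  -- Monotonicity and positivity of the lower modulus give uniform continuity of the inverse, and
  -- injectivity as well.
  · have hinv : ∀ δ > 0, ∃ ε > 0, ∀ {x y}, dist (f x) (f y) < ε → dist x y < δ := by
      refine fun δ hδ => ⟨gaussModulus δ ^ p.toReal⁻¹,
        Real.rpow_pos_of_pos (gaussModulus_pos hδ) _, fun {x y} h => ?_⟩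
      by_contra! hle
      exact absurd ((hmono hδ.le hle).trans (hf x y).2) (not_le.2 h)
    have hlip : LipschitzWith 64 f := LipschitzWith.of_dist_le_mul fun x y => (hf x y).1
    refine Metric.isUniformEmbedding_iff.2 ⟨fun x y hxy => ?_, hlip.uniformContinuous, hinv⟩
    refine eq_of_forall_dist_le fun δ hδ => ?_
    obtain ⟨ε, hε, h⟩ := hinv δ hδ
    exact (h (by rwa [hxy, dist_self])).le

end OrliczFunction
end

theorem mainTheorem5 :
    ∃ M : OrliczFunction,
      (∀ t ∈ Set.Ioc (0 : ℝ) 1, M t = t ^ 2 / (1 - Real.log t)) ∧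
      M.lowerIndex = 2 ∧ M.upperIndex = 2 ∧
      (∀ (p : ENNReal) [Fact (1 ≤ p)], p ≤ 2 →
        ¬ CoarselyEmbeds M.h (RealEllP p) ∧ ¬ UniformlyEmbeds M.h (RealEllP p)) ∧
      ∃ M₀ : OrliczFunction,
        (∀ t : ℝ, 0 ≤ t → M₀ t = t ^ 2) ∧
        M₀.lowerIndex = 2 ∧ M₀.upperIndex = 2 ∧
        ∀ (p : ENNReal) [Fact (1 ≤ p)], p ≤ 2 → StronglyUniformlyEmbeds M₀.h (RealEllP p) := by
  refine ⟨OrliczFunction.logQuad, fun t ht => OrliczFunction.logQuad_apply ht.2,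
    OrliczFunction.logQuad_index.1, OrliczFunction.logQuad_index.2,
    fun p _ hp => ⟨not_coarselyEmbeds_logQuad p hp, not_uniformlyEmbeds_logQuad p hp⟩,
    OrliczFunction.quad, fun t _ => OrliczFunction.quad_apply t,
    OrliczFunction.quad_index.1, OrliczFunction.quad_index.2,
    fun p _ hp => OrliczFunction.stronglyUniformlyEmbeds_quad p hp⟩
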